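/- **Setting.** There are $n\ge 1$ agents, $m\ge 1$ items and $T\ge n$ rounds. For each agent $i$ and item $e$ let $D_{ie}$ be a probability distribution on $[0,1]$ with mean $\mu_{ie}$. The values $v^t_{ie}\sim D_{ie}$ ($t=1,\dots,T$) are mutually independent. An allocation is a matrix $a\in\{0,1\}^{n\times m}$ with $\sum_i a_{ie}=1$ for every $e$. In round $t$ an algorithm chooses an allocation $a^t$ depending only on the previous allocations, the previous feedback and possibly internal randomness independent of all values, and then observes $v^t_{ie}$ for the pairs with $a^t_{ie}=1$. Let $x^1,\dots,x^T$ be allocations maximizing $\min_i\sum_{t}\sum_e\mu_{ie}x^t_{ie}$. The regret is $$R_T=\mathbb E\Bigl[\min_i\sum_{t=1}^T\sum_e v^t_{ie}x^t_{ie}-\min_i\sum_{t=1}^T\sum_e v^t_{ie}a^t_{ie}\Bigr].$$ Let $P^*$ be the maximum of $P$ over all $P\in\mathbb R$, $x\in[0,1]^{n\times m}$ with $\sum_i x_{ie}=1$ for all $e$ and $P\le\sum_e\mu_{ie}x_{ie}$ for all $i$. **Algorithm** (parameters $\epsilon\in(0,1)$ and $C_{\rm rad}$). In rounds $t=1,\dots,n$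 all items go to agent $t$. Put $u^n_i=0$. In round $t>n$ let $N_{ie}$ be the number of earlier rounds in which $i$ received $e$, $\hat v_{ie}$ the average of the corresponding $N_{ie}$ observed values, and $\bar v^t_{ie}=\hat v_{ie}+\sqrt{C_{\rm rad}\hat v_{ie}/N_{ie}}+C_{\rm rad}/N_{ie}$; choose as $a^t$ an allocation $a$ maximizing $\sum_{i,e}(1-\epsilon)^{u_i^{t-1}/m}\,\bar v^t_{ie}\,a_{ie}$ (ties broken arbitrarily), and set $u^t_i=u^{t-1}_i+\sum_e\bar v^t_{ie}a^t_{ie}$. **Theorem.** There is an absolute constant $c_0>0$ such that for every $c_1\ge c_0$ the following holds with constants in the $O(\cdot)$ that depend only on $c_1$. Let $c_0\ln(mnT)\le C_{\rm rad}\le c_1\ln(mnT)$, $W'=P^*(T-n)$ and $\mathrm{err}=\sqrt{C_{\rm rad}m^2T}+C_{\rm rad}\,m\ln T$. Then the regret of the algorithm satisfies $$R_T\le m+P^*+W'\Bigl(\epsilon+n\,e^{-\epsilon^2W'/(2m)}\Bigr)+O\bigl(m\sqrt{T\ln T}+\mathrm{err}\bigr).$$ If moreover $P^*>0$, $T\ge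 e^{2m/P^*}+n$ and $\epsilon=\ln(T-n)/\sqrt{T-n}$, then $$R_T=O\Bigl(\frac mn\sqrt T\ln T+\mathrm{err}\Bigr),$$ and hence, if in addition $T\ge(\ln T)^2\ln(mnT)$, $$R_T=O\Bigl(\frac mn\sqrt T\ln T+m\sqrt{T\ln(mnT)}\Bigr).$$ -/

import Mathlib

open MeasureTheory ProbabilityTheory

noncomputable section

namespace BMMFA

/-- An allocation of `m` items to `n` agents: `a e` is the agent who receives item `e`
(every item goes to exactly one agent). -/
abbrev Alloc (n m : ℕ) := Fin m → Fin n

/-- The entry in row `i` and column `e` of the 0-1 matrix of the allocation `a`. -/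
def assigned {n m : ℕ} (a : Alloc n m) (i : Fin n) (e : Fin m) : ℝ :=
  if a e = i then 1 else 0

/-- Cumulative utility of agent `i` over `T` rounds, when `w t i e` is the value of item `e` for
agent `i` in round `t`. Rounds are numbered `0, …, T - 1`. -/
def utility {n m : ℕ} (T : ℕ) (w : ℕ → Fin n → Fin m → ℝ) (a : ℕ → Alloc n m) (i : Fin n) : ℝ :=
  ∑ t ∈ Finset.range T, ∑ e, w t i e * assigned (a t) i e

/-- Egalitarian social welfare: the smallest cumulative utility among the agents. -/
def welfare {n m : ℕ} (T : ℕ) (w : ℕ → Fin n → Fin m → ℝ) (a : ℕ → Alloc n m) : ℝ :=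
  ⨅ i : Fin n, utility T w a i

/-- `x` is a sequence of allocations chosen by an optimal policy: it maximizes the egalitarian
social welfare with respect to the expected values `μ`. -/
def IsOptimalSeq {n m : ℕ} (T : ℕ) (μ : Fin n → Fin m → ℝ) (x : ℕ → Alloc n m) : Prop :=
  ∀ y : ℕ → Alloc n m, welfare T (fun _ => μ) y ≤ welfare T (fun _ => μ) x

/-- The regret `E[OPT - ALG]` of the random sequence of allocations `a` against `x`, where
`v t i e` is the random value of item `e` for agent `i` in round `t`. -/
def regret {Ω : Type*} [MeasurableSpace Ω] (P : Measure Ω) {n m : ℕ} (T : ℕ)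
    (v : ℕ → Fin n → Fin m → Ω → ℝ) (x : ℕ → Alloc n m) (a : ℕ → Ω → Alloc n m) : ℝ :=
  ∫ ω, (welfare T (fun t i e => v t i e ω) x
    - welfare T (fun t i e => v t i e ω) (fun t => a t ω)) ∂P

/-- Feasibility of `(p, x)` in the linear program that relaxes the offline problem. -/
structure LPFeasible {n m : ℕ} (μ : Fin n → Fin m → ℝ) (p : ℝ) (x : Fin n → Fin m → ℝ) :
    Prop where
  le_utility : ∀ i, p ≤ ∑ e, μ i e * x i e
  sum_eq_one : ∀ e, ∑ i, x i e = 1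
  nonneg : ∀ i e, 0 ≤ x i e
  le_one : ∀ i e, x i e ≤ 1

/-- `(p, x)` is an optimal solution of the linear program with objective `T * p`. -/
def IsLPOptimal {n m : ℕ} (T : ℕ) (μ : Fin n → Fin m → ℝ) (p : ℝ) (x : Fin n → Fin m → ℝ) :
    Prop :=
  LPFeasible μ p x ∧ ∀ p' x', LPFeasible μ p' x' → (T : ℝ) * p' ≤ (T : ℝ) * p

/-- Confidence radius. -/
def rad (C v : ℝ) (N : ℕ) : ℝ := √(C * v / N) + C / N

section Algorithm

variable {n m : ℕ}

/-- The number of rounds before round `t` in which item `e` is assigned to agent `i`. -/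
def count (a : ℕ → Alloc n m) (t : ℕ) (i : Fin n) (e : Fin m) : ℕ :=
  ((Finset.range t).filter (fun s => a s e = i)).card

/-- The average of the values of item `e` for agent `i` observed before round `t`. -/
def sampleMean (a : ℕ → Alloc n m) (v : ℕ → Fin n → Fin m → ℝ) (t : ℕ) (i : Fin n) (e : Fin m) :
    ℝ :=
  (∑ s ∈ (Finset.range t).filter (fun s => a s e = i), v s i e) / (count a t i e : ℝ)

/-- The upper confidence bound used in round `t`. -/
def ucb (C : ℝ) (a : ℕ → Alloc n m) (v : ℕ → Fin n → Fin m → ℝ) (t : ℕ) (i : Fin n)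
    (e : Fin m) : ℝ :=
  sampleMean a v t i e + rad C (sampleMean a v t i e) (count a t i e)

/-- The cumulative utility of agent `i`, measured by the upper confidence bounds, of the rounds
from round `n` on (the rounds after the initialization) and before round `t`. -/
def cumUcb (C : ℝ) (a : ℕ → Alloc n m) (v : ℕ → Fin n → Fin m → ℝ) (t : ℕ) (i : Fin n) : ℝ :=
  ∑ s ∈ Finset.Ico n t, ∑ e, ucb C a v s i e * assigned (a s) i e

/-- The objective that the algorithm maximizes over the allocations `b` in round `t`. -/
def discountedValue (C ε : ℝ) (a : ℕ → Alloc n m) (v : ℕ → Fin n → Fin m → ℝ) (t : ℕ)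
    (b : Alloc n m) : ℝ :=
  ∑ i, ∑ e, (1 - ε) ^ ((1 / (m : ℝ)) * cumUcb C a v t i) * ucb C a v t i e * assigned b i e

/-- `a` is a sequence of allocations produced by the algorithm on the table of values `v`: in each
of the first `n` rounds all items go to one agent, every agent being served once, and each later
allocation maximizes the discounted value. Only the entries `v s i e` with `a s e = i` matter. -/
structure IsRun (T : ℕ) (C ε : ℝ) (a : ℕ → Alloc n m) (v : ℕ → Fin n → Fin m → ℝ) : Prop where
  init : ∀ (t : ℕ) (ht : t < n) (e : Fin m), a t e = ⟨t, ht⟩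
  greedy : ∀ t, n ≤ t → t < T → ∀ b : Alloc n m,
    discountedValue C ε a v t b ≤ discountedValue C ε a v t (a t)

/-- The information available when the allocation of round `t` is chosen: the internal random seed
`ξ` (used to break ties), the earlier allocations, and the earlier semi-bandit feedback, that is
the value of each item for the agent who received it. -/
abbrev info {Ω S : Type*} [MeasurableSpace S] (ξ : Ω → S) (v : ℕ → Fin n → Fin m → Ω → ℝ)
    (a : ℕ → Ω → Alloc n m) (t : ℕ) : MeasurableSpace Ω :=
  MeasurableSpace.comap ξ inferInstance ⊔
    ⨆ (s : ℕ) (_ : s < t),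
      (MeasurableSpace.comap (a s) inferInstance ⊔
        MeasurableSpace.comap (fun ω (e : Fin m) => v s (a s ω e) e ω) inferInstance)

end Algorithm

end BMMFA

end

noncomputable section

namespace BMMFA

/-! ### Scalar inequalities and counting of assignments. -/

section

/-! The algorithm is multiplicative weights over the agents, run on optimistic estimates. The sum of
the weights is the potential. An optimistic gain shrinks an agent's weight, so the potential decays
exponentially in the weighted gain (`potential_le`). Every single weight is at most the potential,
so the optimistic utility of every agent is large (`le_cumUcb`).

The weighted gain is compared with the LP value. Averaging the LP constraints of the agents with the
normalized weights gives one inequality that splits over items; for each item the greedy choice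
beats the LP share whenever the confidence bounds dominate the means (`lp_le_truncGain`). The
potential step needs gains of at most `1` per item, so confidence bounds are truncated there.
Charging the truncation loss `3√(C/N)` additively for every agent and item would cost about
`m√(nCT)`. Instead it is charged additively only while `N ≤ T/n²`, and afterwards as a fraction
`3n√(C/T)` of the gain, which is at most `mT/n` in the case that matters. Both charges are of order
`m√(CT)` (`item_loss_le`, `lp_le_sum_truncGain`). Summing the confidence widths along the run costs
another `m√(CT) + mC(1 + log T)` to pass from optimistic to realized utilities
(`Accurate.cumUcb_le`), and `le_welfare` collects everything.

Accuracy of the confidence bounds has high probability. The values of an item seen by an agent are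
sampled adaptively, but the current value is independent of the past, so the exponential products
are supermartingales (`lintegral_prod_observed_le`). Markov's inequality and a union bound over
rounds, sample sizes, agents and items give `measure_not_accurate_le`. Finally, the expected
benchmark is at most `T` times the LP value (`integral_welfare_le`, `IsLPOptimal.welfare_le`). -/

lemma sum_sqrt_div_le {C : ℝ} (hC : 0 ≤ C) (N : ℕ) :
    ∑ k ∈ Finset.range (N + 1), √(C / k) ≤ 2 * √(C * N) := by
  induction N with
  -- The term `k = 0` is harmless: `C / 0 = 0`.
  | zero => simp
  | succ N ih =>
    rw [Finset.sum_range_succ]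
    refine (add_le_add_left ih _).trans ?_
    have hs : √(C / ((N + 1 : ℕ) : ℝ)) = √C / √((N + 1 : ℕ) : ℝ) := Real.sqrt_div hC _
    rw [hs, Real.sqrt_mul hC, Real.sqrt_mul hC]
    set x := √(N : ℝ)
    set y := √((N + 1 : ℕ) : ℝ)
    have hx : x ^ 2 = N := Real.sq_sqrt (by positivity)
    have hy : y ^ 2 = N + 1 := by rw [Real.sq_sqrt (by positivity)]; push_cast; rfl
    have hy0 : 0 < y := Real.sqrt_pos.mpr (by positivity)
    -- Since `y² - x² = 1`, one has `2y(y - x) = 1 + (y - x)² ≥ 1`.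
    have key : 2 * x + 1 / y ≤ 2 * y := by
      have h : 2 * x * y + 1 ≤ 2 * y * y := by nlinarith [sq_nonneg (x - y)]
      rw [← sub_nonneg]
      have : 2 * y - (2 * x + 1 / y) = (2 * y * y - (2 * x * y + 1)) / y := by
        field_simp
      rw [this]
      exact div_nonneg (by linarith) hy0.le
    calc 2 * (√C * x) + √C / y = √C * (2 * x + 1 / y) := by ring
      _ ≤ √C * (2 * y) := mul_le_mul_of_nonneg_left key (Real.sqrt_nonneg _)
      _ = 2 * (√C * y) := by ring

lemma sum_range_sqrt_div_le {C : ℝ} (hC : 0 ≤ C) (N : ℕ) :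
    ∑ k ∈ Finset.range N, √(C / k) ≤ 2 * √(C * N) := by
  refine le_trans ?_ (sum_sqrt_div_le hC N)
  exact Finset.sum_le_sum_of_subset_of_nonneg (Finset.range_mono (Nat.le_succ N))
    fun _ _ _ => Real.sqrt_nonneg _

lemma sum_range_div_le {C : ℝ} (hC : 0 ≤ C) {N T : ℕ} (hN : N ≤ T) :
    ∑ k ∈ Finset.range N, C / k ≤ C * (1 + Real.log T) := by
  have h1 : ∑ k ∈ Finset.range N, C / (k : ℝ) ≤ ∑ k ∈ Finset.range (T + 1), C / (k : ℝ) :=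
    Finset.sum_le_sum_of_subset_of_nonneg (Finset.range_mono (by omega))
      fun _ _ _ => by positivity
  refine h1.trans ?_
  rw [Finset.sum_range_succ']
  simp only [Nat.cast_zero, inv_zero, mul_zero, add_zero, div_eq_mul_inv, ← Finset.mul_sum]
  have := harmonic_le_one_add_log T
  rw [harmonic] at this
  push_cast at this
  push_cast
  exact mul_le_mul_of_nonneg_left this hC

/-- The bound does not depend on `N`: it pays for the additive part of the truncation loss, at
sample sizes up to `K`. -/
lemma sum_filter_sqrt_div_le {C K : ℝ} (hC : 0 ≤ C) (hK : 0 ≤ K) (N : ℕ) :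
    ∑ k ∈ Finset.range N, (if (k : ℝ) ≤ K then √(C / k) else 0) ≤ 2 * √(C * K) := by
  have h1 : ∑ k ∈ Finset.range N, (if (k : ℝ) ≤ K then √(C / k) else 0)
      ≤ ∑ k ∈ Finset.range (⌊K⌋₊ + 1), √(C / k) := by
    rw [← Finset.sum_filter]
    refine Finset.sum_le_sum_of_subset_of_nonneg ?_ fun _ _ _ => Real.sqrt_nonneg _
    intro k hk
    rw [Finset.mem_filter] at hk
    exact Finset.mem_range.mpr (Nat.lt_succ_of_le (Nat.le_floor hk.2))
  refine h1.trans ((sum_sqrt_div_le hC _).trans ?_)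
  gcongr
  exact Nat.floor_le hK

/-- This is `x ≤ sinh x` at `x = -log (1 - ε)`. The term `ε² / 2` is the slack that later absorbs `m
log n`. -/
lemma one_sub_mul_neg_log_le {ε : ℝ} (h0 : 0 < ε) (h1 : ε < 1) :
    (1 - ε) * (-Real.log (1 - ε)) ≤ ε - ε ^ 2 / 2 := by
  have hs : 0 < 1 - ε := by linarith
  have hx : 0 ≤ -Real.log (1 - ε) := by
    have := Real.log_nonpos hs.le (by linarith)
    linarith
  have h := Real.self_le_sinh_iff.mpr hx
  rw [Real.sinh_eq, neg_neg, Real.exp_log hs, Real.exp_neg, Real.exp_log hs] at h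
  calc (1 - ε) * (-Real.log (1 - ε)) ≤ (1 - ε) * (((1 - ε)⁻¹ - (1 - ε)) / 2) :=
        mul_le_mul_of_nonneg_left h hs.le
    _ = ε - ε ^ 2 / 2 := by field_simp; ring

/-- Invert `1 + x + x²/2 ≤ exp x` and use `(1 + x + x²/2)(1 - x + x²/2) = 1 + x⁴/4`. -/
lemma exp_neg_le_quadratic {x : ℝ} (hx : 0 ≤ x) : Real.exp (-x) ≤ 1 - x + x ^ 2 / 2 := by
  have h1 : 1 + x + x ^ 2 / 2 ≤ Real.exp x := Real.quadratic_le_exp_of_nonneg hx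
  have h2 : 0 < 1 + x + x ^ 2 / 2 := by positivity
  rw [Real.exp_neg]
  refine (inv_anti₀ h2 h1).trans ?_
  rw [inv_le_iff_one_le_mul₀ h2]
  nlinarith [sq_nonneg (x ^ 2)]

variable {n m : ℕ}

lemma count_succ (a : ℕ → Alloc n m) (t : ℕ) (i : Fin n) (e : Fin m) :
    count a (t + 1) i e = count a t i e + if a t e = i then 1 else 0 := by
  unfold count
  rw [Finset.range_add_one, Finset.filter_insert]
  split_ifs
  · rw [Finset.card_insert_of_notMem (by simp)]
  · simp

lemma count_le (a : ℕ → Alloc n m) (t : ℕ) (i : Fin n) (e : Fin m) : count a t i e ≤ t := by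
  unfold count
  exact (Finset.card_filter_le _ _).trans (by simp)

/-- Over the rounds in which `i` receives `e`, the earlier count runs through `0, 1, 2, …` once
each. This turns sums of confidence widths over rounds into sums over sample sizes. -/
lemma sum_count_eq (a : ℕ → Alloc n m) (h : ℕ → ℝ) (T : ℕ) (i : Fin n) (e : Fin m) :
    ∑ t ∈ Finset.range T, (if a t e = i then h (count a t i e) else 0)
      = ∑ k ∈ Finset.range (count a T i e), h k := by
  induction T with
  | zero => simp [count]
  | succ T ih =>
    rw [Finset.sum_range_succ, ih, count_succ]
    split_ifs
    · rw [Finset.sum_range_succ]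
    · simp

lemma sum_Ico_count_le (a : ℕ → Alloc n m) {h : ℕ → ℝ} (hh : ∀ k, 0 ≤ h k) (r T : ℕ) (i : Fin n)
    (e : Fin m) :
    ∑ t ∈ Finset.Ico r T, (if a t e = i then h (count a t i e) else 0)
      ≤ ∑ k ∈ Finset.range (count a T i e), h k := by
  rw [← sum_count_eq]
  refine Finset.sum_le_sum_of_subset_of_nonneg (fun t ht => ?_) fun t _ _ => ?_
  · rw [Finset.mem_Ico] at ht
    exact Finset.mem_range.mpr ht.2
  · split_ifs
    exacts [hh _, le_rfl]

lemma count_pos {T : ℕ} {C ε : ℝ} {a : ℕ → Alloc n m} {v : ℕ → Fin n → Fin m → ℝ}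
    (h : IsRun T C ε a v) {t : ℕ} (ht : n ≤ t) (i : Fin n) (e : Fin m) : 0 < count a t i e := by
  unfold count
  rw [Finset.card_pos]
  exact ⟨i, Finset.mem_filter.mpr ⟨Finset.mem_range.mpr (i.2.trans_le ht), h.init i i.2 e⟩⟩

lemma sum_mul_assigned (f : Fin n → ℝ) (a : Alloc n m) (e : Fin m) :
    ∑ i, f i * assigned a i e = f (a e) := by
  simp [assigned]

lemma assigned_nonneg (a : Alloc n m) (i : Fin n) (e : Fin m) : 0 ≤ assigned a i e := by
  unfold assigned; split_ifs <;> norm_num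

lemma assigned_le_one (a : Alloc n m) (i : Fin n) (e : Fin m) : assigned a i e ≤ 1 := by
  unfold assigned; split_ifs <;> norm_num

end

/-! ### Deterministic analysis: potential, comparison with the linear program, welfare. -/

section

variable {n m : ℕ}

/-- The weight of agent `i` in round `t`. -/
def weight (C ε : ℝ) (a : ℕ → Alloc n m) (v : ℕ → Fin n → Fin m → ℝ) (t : ℕ) (i : Fin n) : ℝ :=
  (1 - ε) ^ ((1 / (m : ℝ)) * cumUcb C a v t i)

/-- The sum of the weights of all agents. -/
def potential (C ε : ℝ) (a : ℕ → Alloc n m) (v : ℕ → Fin n → Fin m → ℝ) (t : ℕ) : ℝ :=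
  ∑ i, weight C ε a v t i

/-- The normalized weighted gain of round `t`, with the confidence bounds truncated at `1`. -/
def truncGain (C ε : ℝ) (a : ℕ → Alloc n m) (v : ℕ → Fin n → Fin m → ℝ) (t : ℕ) : ℝ :=
  ∑ e, weight C ε a v t (a t e) / potential C ε a v t * min (ucb C a v t (a t e) e) 1

variable {C ε : ℝ} {a : ℕ → Alloc n m} {v : ℕ → Fin n → Fin m → ℝ} {T : ℕ}

lemma weight_pos (hε : ε < 1) (t : ℕ) (i : Fin n) : 0 < weight C ε a v t i :=
  Real.rpow_pos_of_pos (by linarith) _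

lemma weight_le_potential (hε : ε < 1) (t : ℕ) (i : Fin n) :
    weight C ε a v t i ≤ potential C ε a v t :=
  Finset.single_le_sum (f := fun i => weight C ε a v t i) (fun j _ => (weight_pos hε t j).le)
    (Finset.mem_univ i)

lemma potential_pos (hn : 0 < n) (hε : ε < 1) (t : ℕ) : 0 < potential C ε a v t :=
  (weight_pos hε t ⟨0, hn⟩).trans_le (weight_le_potential hε t _)

lemma discountedValue_eq (t : ℕ) (b : Alloc n m) :
    discountedValue C ε a v t b = ∑ e, weight C ε a v t (b e) * ucb C a v t (b e) e := by
  unfold discountedValue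
  rw [Finset.sum_comm]
  exact Finset.sum_congr rfl fun e _ =>
    sum_mul_assigned (fun i => weight C ε a v t i * ucb C a v t i e) b e

/-- The objective separates over items, so changing the recipient of one item alone cannot improve
it. -/
lemma IsRun.greedy_item (h : IsRun T C ε a v) {t : ℕ} (h1 : n ≤ t) (h2 : t < T) (e : Fin m)
    (j : Fin n) :
    weight C ε a v t j * ucb C a v t j e
      ≤ weight C ε a v t (a t e) * ucb C a v t (a t e) e := by
  have hb := h.greedy t h1 h2 (Function.update (a t) e j)
  rw [discountedValue_eq, discountedValue_eq, ← Finset.add_sum_erase _ _ (Finset.mem_univ e),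
    ← Finset.add_sum_erase Finset.univ
      (fun e => weight C ε a v t (a t e) * ucb C a v t (a t e) e) (Finset.mem_univ e)] at hb
  have hs : ∑ x ∈ Finset.univ.erase e, weight C ε a v t (Function.update (a t) e j x)
        * ucb C a v t (Function.update (a t) e j x) x
      = ∑ x ∈ Finset.univ.erase e, weight C ε a v t (a t x) * ucb C a v t (a t x) x := by
    refine Finset.sum_congr rfl fun x hx => ?_
    rw [Function.update_of_ne (Finset.ne_of_mem_erase hx)]
  rw [hs, Function.update_self] at hb
  linarith

lemma weight_succ (hε : ε < 1) {t : ℕ} (ht : n ≤ t) (i : Fin n) :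
    weight C ε a v (t + 1) i = weight C ε a v t i
      * (1 - ε) ^ ((1 / (m : ℝ)) * ∑ e, ucb C a v t i e * assigned (a t) i e) := by
  unfold weight cumUcb
  rw [Finset.sum_Ico_succ_top ht, mul_add, Real.rpow_add (by linarith)]

/-- Bernoulli's inequality `(1 - ε)^s ≤ 1 - εs` needs `s ≤ 1`. Truncating each item at `1` ensures
this after division by `m`, and only increases the power. -/
lemma rpow_gain_le (hm : 0 < m) (h0 : 0 < ε) (h1 : ε < 1) {g : Fin m → ℝ} {b : Fin m → ℝ}
    (hg : ∀ e, 0 ≤ g e) (hb0 : ∀ e, 0 ≤ b e) (hb1 : ∀ e, b e ≤ 1) :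
    (1 - ε) ^ ((1 / (m : ℝ)) * ∑ e, g e * b e) ≤ 1 - ε / m * ∑ e, min (g e) 1 * b e := by
  have hm' : (0 : ℝ) < m := by exact_mod_cast hm
  have hle : ∑ e, min (g e) 1 * b e ≤ ∑ e, g e * b e :=
    Finset.sum_le_sum fun e _ => mul_le_mul_of_nonneg_right (min_le_left _ _) (hb0 e)
  have h0' : 0 ≤ ∑ e, min (g e) 1 * b e :=
    Finset.sum_nonneg fun e _ => mul_nonneg (le_min (hg e) zero_le_one) (hb0 e)
  have hm1 : ∑ e, min (g e) 1 * b e ≤ m := by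
    calc ∑ e, min (g e) 1 * b e ≤ ∑ _e : Fin m, (1 : ℝ) :=
          Finset.sum_le_sum fun e _ =>
            mul_le_one₀ (min_le_right _ _) (hb0 e) (hb1 e)
      _ = m := by simp
  calc (1 - ε) ^ ((1 / (m : ℝ)) * ∑ e, g e * b e)
      ≤ (1 - ε) ^ ((1 / (m : ℝ)) * ∑ e, min (g e) 1 * b e) :=
        Real.rpow_le_rpow_of_exponent_ge (by linarith) (by linarith) (by gcongr)
    _ = (1 + -ε) ^ ((1 / (m : ℝ)) * ∑ e, min (g e) 1 * b e) := by rw [sub_eq_add_neg]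
    _ ≤ 1 + (1 / (m : ℝ)) * (∑ e, min (g e) 1 * b e) * -ε := by
        refine rpow_one_add_le_one_add_mul_self (by linarith) (by positivity) ?_
        rw [one_div, inv_mul_le_iff₀ hm', mul_one]
        exact hm1
    _ = 1 - ε / m * ∑ e, min (g e) 1 * b e := by ring

lemma potential_succ_le (hn : 0 < n) (hm : 0 < m) (h0 : 0 < ε) (h1 : ε < 1) {t : ℕ} (ht : n ≤ t)
    (hV : ∀ i e, 0 ≤ ucb C a v t i e) :
    potential C ε a v (t + 1)
      ≤ potential C ε a v t * Real.exp (-(ε / m * truncGain C ε a v t)) := by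
  have hΦ := potential_pos (C := C) (a := a) (v := v) hn h1 t
  have hstep : potential C ε a v (t + 1)
      ≤ potential C ε a v t - ε / m * ∑ e, weight C ε a v t (a t e) * min (ucb C a v t (a t e) e) 1 := by
    calc potential C ε a v (t + 1)
        ≤ ∑ i, weight C ε a v t i
            * (1 - ε / m * ∑ e, min (ucb C a v t i e) 1 * assigned (a t) i e) := by
          refine Finset.sum_le_sum fun i _ => ?_
          rw [weight_succ h1 ht]
          exact mul_le_mul_of_nonneg_left (rpow_gain_le hm h0 h1 (hV i) (assigned_nonneg _ i)
            (assigned_le_one _ i)) (weight_pos h1 t i).le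
      _ = potential C ε a v t
          - ε / m * ∑ i, ∑ e, weight C ε a v t i * min (ucb C a v t i e) 1 * assigned (a t) i e := by
          rw [potential, Finset.mul_sum, ← Finset.sum_sub_distrib]
          refine Finset.sum_congr rfl fun i _ => ?_
          rw [mul_sub, mul_one, mul_left_comm, Finset.mul_sum]
          simp only [mul_assoc]
      _ = _ := by
          rw [Finset.sum_comm]
          congr 2
          exact Finset.sum_congr rfl fun e _ =>
            sum_mul_assigned (fun i => weight C ε a v t i * min (ucb C a v t i e) 1) (a t) e
  have hg : ∑ e, weight C ε a v t (a t e) * min (ucb C a v t (a t e) e) 1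
      = potential C ε a v t * truncGain C ε a v t := by
    rw [truncGain, Finset.mul_sum]
    exact Finset.sum_congr rfl fun e _ => by field_simp
  rw [hg] at hstep
  refine hstep.trans ?_
  have hexp := Real.add_one_le_exp (-(ε / m * truncGain C ε a v t))
  nlinarith [mul_le_mul_of_nonneg_left hexp hΦ.le]

lemma potential_le (hn : 0 < n) (hm : 0 < m) (h0 : 0 < ε) (h1 : ε < 1) {t : ℕ} (ht : n ≤ t)
    (hV : ∀ s, n ≤ s → s < t → ∀ i e, 0 ≤ ucb C a v s i e) :
    potential C ε a v t
      ≤ n * Real.exp (-(ε / m * ∑ s ∈ Finset.Ico n t, truncGain C ε a v s)) := by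
  induction t, ht using Nat.le_induction with
  | base => simp [potential, weight, cumUcb]
  | succ t ht ih =>
    refine (potential_succ_le hn hm h0 h1 ht (hV t ht (Nat.lt_succ_self t))).trans ?_
    rw [Finset.sum_Ico_succ_top ht, mul_add, neg_add, Real.exp_add, ← mul_assoc]
    exact mul_le_mul_of_nonneg_right
      (ih fun s hs hst => hV s hs (hst.trans (Nat.lt_succ_self t))) (Real.exp_pos _).le

/-- The logarithm of "one weight is at most the potential", multiplied by `m`. The left side has
truncated gains, the right side untruncated ones. -/
lemma le_cumUcb (hn : 0 < n) (hm : 0 < m) (h0 : 0 < ε) (h1 : ε < 1) (hT : n ≤ T)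
    (hV : ∀ s, n ≤ s → s < T → ∀ i e, 0 ≤ ucb C a v s i e) (i : Fin n) :
    ε * ∑ s ∈ Finset.Ico n T, truncGain C ε a v s - m * Real.log n
      ≤ -Real.log (1 - ε) * cumUcb C a v T i := by
  have hm' : (0 : ℝ) < m := by exact_mod_cast hm
  have hn' : (0 : ℝ) < n := by exact_mod_cast hn
  have h := (weight_le_potential (C := C) (a := a) (v := v) h1 T i).trans
    (potential_le hn hm h0 h1 hT hV)
  have hl := Real.log_le_log (weight_pos h1 T i) h
  rw [Real.log_mul hn'.ne' (Real.exp_pos _).ne', Real.log_exp, weight,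
    Real.log_rpow (by linarith)] at hl
  have := mul_le_mul_of_nonneg_left hl hm'.le
  have e1 : (m : ℝ) * (1 / m * cumUcb C a v T i * Real.log (1 - ε))
      = cumUcb C a v T i * Real.log (1 - ε) := by field_simp
  have e2 : (m : ℝ) * (Real.log n + -(ε / m * ∑ s ∈ Finset.Ico n T, truncGain C ε a v s))
      = m * Real.log n - ε * ∑ s ∈ Finset.Ico n T, truncGain C ε a v s := by
    field_simp
    ring
  rw [e1, e2] at this
  linarith

lemma truncGain_nonneg (hn : 0 < n) (h1 : ε < 1) {t : ℕ} (hV : ∀ i e, 0 ≤ ucb C a v t i e) :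
    0 ≤ truncGain C ε a v t :=
  Finset.sum_nonneg fun e _ => mul_nonneg
    (div_nonneg (weight_pos h1 t _).le (potential_pos hn h1 t).le) (le_min (hV _ e) zero_le_one)

/-- The confidence bounds and the observed sums are accurate. -/
structure Accurate (T : ℕ) (C : ℝ) (a : ℕ → Alloc n m) (v : ℕ → Fin n → Fin m → ℝ)
    (μ : Fin n → Fin m → ℝ) : Prop where
  lower : ∀ t, n ≤ t → t < T → ∀ i e, μ i e ≤ ucb C a v t i e
  upper : ∀ t, n ≤ t → t < T → ∀ i e,
    ucb C a v t i e ≤ μ i e + (2 * √(C / count a t i e) + C / count a t i e)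
  sum : ∀ i e, (count a T i e : ℝ) * μ i e - √(C * count a T i e)
    ≤ ∑ s ∈ (Finset.range T).filter (fun s => a s e = i), v s i e

variable {μ : Fin n → Fin m → ℝ}

/-- The part of the linear program's value that an item contributes exceeds its truncated gain by
an amount that is controlled by the confidence radius. -/
lemma item_loss_le {p V μ' q R K N : ℝ} (hC : 0 ≤ C) (hp0 : 0 ≤ p) (hq1 : q ≤ 1)
    (hq : q ≤ p * V) (hμ : μ' ≤ 1) (hN : 0 < N) (hV0 : 0 ≤ V)
    (hV : V ≤ μ' + (2 * √(C / N) + C / N)) (hK : C ≤ K) (hK0 : 0 < K) (hR : R = 3 * √(C / K)) :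
    q ≤ p * min V 1 + ((if N ≤ K then 3 * √(C / N) else 0) + R * (p * min V 1)) := by
  have hz : 0 ≤ p * min V 1 := mul_nonneg hp0 (le_min hV0 zero_le_one)
  have hR0 : 0 ≤ R := by rw [hR]; positivity
  have hsq : √(C / N) ^ 2 = C / N := Real.sq_sqrt (by positivity)
  have hs0 := Real.sqrt_nonneg (C / N)
  rcases le_or_gt V 1 with h | h
  · rw [min_eq_left h] at hz ⊢
    have : 0 ≤ (if N ≤ K then 3 * √(C / N) else 0) := by split_ifs <;> positivity
    nlinarith [mul_nonneg hR0 hz]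
  · rw [min_eq_right h.le, mul_one] at hz ⊢
    rcases le_or_gt p 1 with hp1 | hp1
    swap
    · have : 0 ≤ (if N ≤ K then 3 * √(C / N) else 0) := by split_ifs <;> positivity
      nlinarith [mul_nonneg hR0 hz]
    split_ifs with hNK
    -- If `s = √(C/N) ≤ 1`, the width `2s + s²` is at most `3s`; otherwise `q ≤ 1 < 3s`.
    · rcases le_or_gt (√(C / N)) 1 with hs | hs
      · have : p * V ≤ p * (1 + 3 * √(C / N)) := by
          apply mul_le_mul_of_nonneg_left _ hp0
          nlinarith
        nlinarith [mul_nonneg hR0 hz]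
      · nlinarith [mul_nonneg hR0 hz]
    · push Not at hNK
      have hle : √(C / N) ≤ √(C / K) := Real.sqrt_le_sqrt (by gcongr)
      have hs : √(C / N) ≤ 1 := by
        rw [Real.sqrt_le_one, div_le_one hN]
        linarith
      have : p * V ≤ p * (1 + 3 * √(C / K)) := by
        apply mul_le_mul_of_nonneg_left _ hp0
        nlinarith
      rw [hR]
      nlinarith

/-- Averaging the LP constraints with the normalized weights bounds `p` by a sum of item shares.
Each share is at most `1`, and by optimism, greediness and `∑ i, x i e = 1` at most the chosen
agent's normalized weight times its confidence bound; `item_loss_le` does the rest. -/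
lemma lp_le_truncGain (h : IsRun T C ε a v) (hA : Accurate T C a v μ) (hn : 0 < n)
    (h1 : ε < 1) (hC : 0 ≤ C) (hμ0 : ∀ i e, 0 ≤ μ i e) (hμ1 : ∀ i e, μ i e ≤ 1)
    {p : ℝ} {x : Fin n → Fin m → ℝ} (hx : LPFeasible μ p x) {K : ℝ} (hK : C ≤ K) (hK0 : 0 < K)
    {t : ℕ} (ht : n ≤ t) (htT : t < T) :
    p ≤ truncGain C ε a v t
      + (∑ i, ∑ e, (if a t e = i then
            (if (count a t i e : ℝ) ≤ K then 3 * √(C / count a t i e) else 0) else 0)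
          + 3 * √(C / K) * truncGain C ε a v t) := by
  have hΦ := potential_pos (C := C) (a := a) (v := v) hn h1 t
  have hV : ∀ i e, 0 ≤ ucb C a v t i e := fun i e => (hμ0 i e).trans (hA.lower t ht htT i e)
  have e1 : ∑ i, ∑ e, (if a t e = i then
        (if (count a t i e : ℝ) ≤ K then 3 * √(C / count a t i e) else 0) else 0)
      = ∑ e, (if (count a t (a t e) e : ℝ) ≤ K then 3 * √(C / count a t (a t e) e) else 0) := by
    rw [Finset.sum_comm]
    exact Finset.sum_congr rfl fun e _ => by simp
  rw [e1]
  have hp : p * potential C ε a v t ≤ ∑ e, ∑ i, weight C ε a v t i * (μ i e * x i e) := by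
    rw [Finset.sum_comm, potential, Finset.mul_sum]
    refine Finset.sum_le_sum fun i _ => ?_
    rw [← Finset.mul_sum, mul_comm p]
    exact mul_le_mul_of_nonneg_left (hx.le_utility i) (weight_pos h1 t i).le
  have hp' : p ≤ ∑ e, (∑ i, weight C ε a v t i * (μ i e * x i e)) / potential C ε a v t := by
    rw [← Finset.sum_div, le_div_iff₀ hΦ]
    exact hp
  refine hp'.trans ?_
  rw [truncGain, Finset.mul_sum, ← Finset.sum_add_distrib, ← Finset.sum_add_distrib]
  refine Finset.sum_le_sum fun e _ => ?_
  refine item_loss_le hC (div_nonneg (weight_pos h1 t _).le hΦ.le) ?_ ?_ (hμ1 (a t e) e)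
    (by exact_mod_cast count_pos h ht _ _) (hV _ _) (hA.upper t ht htT _ _) hK hK0 rfl
  · rw [div_le_one hΦ]
    refine Finset.sum_le_sum fun i _ => ?_
    have : μ i e * x i e ≤ 1 := mul_le_one₀ (hμ1 i e) (hx.nonneg i e) (hx.le_one i e)
    nlinarith [weight_pos (C := C) (a := a) (v := v) h1 t i]
  · rw [div_mul_eq_mul_div]
    gcongr
    calc ∑ i, weight C ε a v t i * (μ i e * x i e)
        ≤ ∑ i, (weight C ε a v t (a t e) * ucb C a v t (a t e) e) * x i e := by
          refine Finset.sum_le_sum fun i _ => ?_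
          rw [← mul_assoc]
          refine mul_le_mul_of_nonneg_right ?_ (hx.nonneg i e)
          exact (mul_le_mul_of_nonneg_left (hA.lower t ht htT i e) (weight_pos h1 t i).le).trans
            (h.greedy_item ht htT e i)
      _ = _ := by rw [← Finset.mul_sum, hx.sum_eq_one e, mul_one]

/-- Add the utility constraints over all agents; each item contributes at most `1`. -/
lemma LPFeasible.mul_le (hμ1 : ∀ i e, μ i e ≤ 1) {p : ℝ}
    {x : Fin n → Fin m → ℝ} (hx : LPFeasible μ p x) : n * p ≤ m := by
  calc n * p = ∑ _i : Fin n, p := by simp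
    _ ≤ ∑ i, ∑ e, μ i e * x i e := Finset.sum_le_sum fun i _ => hx.le_utility i
    _ ≤ ∑ i, ∑ e, x i e := Finset.sum_le_sum fun i _ => Finset.sum_le_sum fun e _ =>
        mul_le_of_le_one_left (hx.nonneg i e) (hμ1 i e)
    _ = ∑ e, ∑ i, x i e := Finset.sum_comm
    _ = m := by simp [hx.sum_eq_one]

/-- The truncated gains add up to nearly the value of the linear program. -/
lemma lp_le_sum_truncGain (h : IsRun T C ε a v) (hA : Accurate T C a v μ) (hn : 0 < n)
    (hT : n ≤ T) (h1 : ε < 1) (hC : 0 < C) (hμ0 : ∀ i e, 0 ≤ μ i e)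
    (hμ1 : ∀ i e, μ i e ≤ 1) {p : ℝ} {x : Fin n → Fin m → ℝ} (hx : LPFeasible μ p x) :
    p * ((T : ℝ) - n) ≤ ∑ t ∈ Finset.Ico n T, truncGain C ε a v t + 9 * (m * √(C * T)) := by
  have hn' : (0 : ℝ) < n := by exact_mod_cast hn
  have hT' : (n : ℝ) ≤ T := by exact_mod_cast hT
  have hT0 : (0 : ℝ) < T := hn'.trans_le hT'
  have hnp := hx.mul_le hμ1
  have hZ0 : 0 ≤ ∑ t ∈ Finset.Ico n T, truncGain C ε a v t := by
    refine Finset.sum_nonneg fun t ht => ?_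
    rw [Finset.mem_Ico] at ht
    exact truncGain_nonneg hn h1 fun i e => (hμ0 i e).trans (hA.lower t ht.1 ht.2 i e)
  set Z := ∑ t ∈ Finset.Ico n T, truncGain C ε a v t with hZ
  have hpT : p * ((T : ℝ) - n) * n ≤ m * T := by nlinarith
  have hE : (0 : ℝ) ≤ m * √(C * T) := by positivity
  rcases le_or_gt (C * n ^ 2) T with hCT | hCT
  swap
  · -- few rounds: the right side exceeds the trivial bound `m * T / n`
    have hs : (T : ℝ) ≤ n * √(C * T) := by
      rw [← Real.sqrt_sq hn'.le, ← Real.sqrt_mul (by positivity)]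
      apply Real.le_sqrt_of_sq_le
      nlinarith
    have : p * ((T : ℝ) - n) * n ≤ (m * √(C * T)) * n := by
      refine hpT.trans ?_
      have hm0 : (0 : ℝ) ≤ m := by positivity
      nlinarith
    have := le_of_mul_le_mul_right this hn'
    linarith
  rcases le_or_gt (p * ((T : ℝ) - n)) Z with hle | hgt
  · linarith
  -- This threshold balances the charges: `n√(CK) = √(CT)` per item for small counts, and `√(C/K) ·
  -- mT/n = m√(CT)` for large ones.
  set K : ℝ := T / n ^ 2 with hKdef
  have hK0 : 0 < K := by positivity
  have hCK : C ≤ K := by rw [hKdef, le_div_iff₀ (by positivity)]; exact hCT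
  have hsum : p * ((T : ℝ) - n) ≤ Z + (∑ i : Fin n, ∑ e : Fin m, ∑ t ∈ Finset.Ico n T,
      (if a t e = i then
        (if (count a t i e : ℝ) ≤ K then 3 * √(C / count a t i e) else 0) else 0)
        + 3 * √(C / K) * Z) := by
    calc p * ((T : ℝ) - n) = ∑ _t ∈ Finset.Ico n T, p := by
          rw [Finset.sum_const, Nat.card_Ico, nsmul_eq_mul, Nat.cast_sub hT, mul_comm]
      _ ≤ ∑ t ∈ Finset.Ico n T, (truncGain C ε a v t
          + (∑ i, ∑ e, (if a t e = i then
            (if (count a t i e : ℝ) ≤ K then 3 * √(C / count a t i e) else 0) else 0)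
          + 3 * √(C / K) * truncGain C ε a v t)) := by
          refine Finset.sum_le_sum fun t ht => ?_
          rw [Finset.mem_Ico] at ht
          exact lp_le_truncGain h hA hn h1 hC.le hμ0 hμ1 hx hCK hK0 ht.1 ht.2
      _ = _ := by
          rw [Finset.sum_add_distrib, Finset.sum_add_distrib, ← Finset.mul_sum, ← hZ,
            Finset.sum_comm]
          congr 2
          exact Finset.sum_congr rfl fun i _ => Finset.sum_comm
  have hsq : √(C * K) * n = √(C * T) := by
    have : C * K * (n : ℝ) ^ 2 = C * T := by rw [hKdef]; field_simp
    rw [← this, Real.sqrt_mul (mul_pos hC hK0).le, Real.sqrt_sq hn'.le]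
  have hfirst : ∑ i : Fin n, ∑ e : Fin m, ∑ t ∈ Finset.Ico n T,
      (if a t e = i then
        (if (count a t i e : ℝ) ≤ K then 3 * √(C / count a t i e) else 0) else 0)
      ≤ 6 * (m * √(C * T)) := by
    calc _ ≤ ∑ _i : Fin n, ∑ _e : Fin m, 3 * (2 * √(C * K)) := by
          refine Finset.sum_le_sum fun i _ => Finset.sum_le_sum fun e _ => ?_
          refine (sum_Ico_count_le a
            (h := fun k => if (k : ℝ) ≤ K then 3 * √(C / k) else 0) (fun k => ?_) n T i e).trans ?_
          · split_ifs <;> positivity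
          · refine le_trans (le_of_eq ?_) (mul_le_mul_of_nonneg_left
              (sum_filter_sqrt_div_le hC.le hK0.le (count a T i e)) (by norm_num : (0 : ℝ) ≤ 3))
            rw [Finset.mul_sum]
            exact Finset.sum_congr rfl fun k _ => by split_ifs <;> simp
      _ = 6 * (m * (√(C * K) * n)) := by
          simp only [Finset.sum_const, Finset.card_univ, Fintype.card_fin, nsmul_eq_mul]
          ring
      _ = _ := by rw [hsq]
  have hsecond : 3 * √(C / K) * Z ≤ 3 * (m * √(C * T)) := by
    have hZ1 : Z * n ≤ m * T := by nlinarith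
    have h3 : √(C / K) * T = √(C * T) * n := by
      have : C / K * T ^ 2 = C * T * n ^ 2 := by rw [hKdef]; field_simp
      rw [← Real.sqrt_sq hT0.le, ← Real.sqrt_mul (by positivity), this,
        Real.sqrt_mul (by positivity), Real.sqrt_sq hn'.le, Real.sqrt_sq hT0.le]
    have h4 : √(C / K) * Z * n ≤ m * √(C * T) * n := by
      calc √(C / K) * Z * n = √(C / K) * (Z * n) := by ring
        _ ≤ √(C / K) * (m * T) := mul_le_mul_of_nonneg_left hZ1 (Real.sqrt_nonneg _)
        _ = m * (√(C / K) * T) := by ring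
        _ = _ := by rw [h3]; ring
    have := le_of_mul_le_mul_right h4 hn'
    linarith
  linarith

/-- The realized utilities nearly reach the utilities measured by the confidence bounds. -/
lemma Accurate.cumUcb_le (hA : Accurate T C a v μ) (hC : 0 ≤ C)
    (hμ0 : ∀ i e, 0 ≤ μ i e) (i : Fin n) :
    cumUcb C a v T i ≤ utility T v a i + m * (5 * √(C * T) + C * (1 + Real.log T)) := by
  have e1 : cumUcb C a v T i
      = ∑ e, ∑ t ∈ Finset.Ico n T, ucb C a v t i e * assigned (a t) i e := Finset.sum_comm
  have e2 : utility T v a i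
      = ∑ e, ∑ t ∈ Finset.range T, v t i e * assigned (a t) i e := Finset.sum_comm
  have e3 : (m : ℝ) * (5 * √(C * T) + C * (1 + Real.log T))
      = ∑ _e : Fin m, (5 * √(C * T) + C * (1 + Real.log T)) := by
    rw [Finset.sum_const, Finset.card_univ, Fintype.card_fin, nsmul_eq_mul]
  rw [e1, e2, e3, ← Finset.sum_add_distrib]
  refine Finset.sum_le_sum fun e _ => ?_
  have hNT : (count a T i e : ℝ) ≤ T := by exact_mod_cast count_le a T i e
  have hs : √(C * count a T i e) ≤ √(C * T) := Real.sqrt_le_sqrt (by gcongr)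
  have h1 : ∑ t ∈ Finset.Ico n T, ucb C a v t i e * assigned (a t) i e
      ≤ ∑ k ∈ Finset.range (count a T i e), (μ i e + (2 * √(C / k) + C / k)) := by
    refine le_trans (Finset.sum_le_sum fun t ht => ?_) (sum_Ico_count_le a
      (h := fun k => μ i e + (2 * √(C / k) + C / k)) (fun k => ?_) n T i e)
    · rw [Finset.mem_Ico] at ht
      unfold assigned
      split_ifs
      · rw [mul_one]
        exact hA.upper t ht.1 ht.2 i e
      · simp
    · have := hμ0 i e
      positivity
  -- The widths give `4√(CT)`; the fifth `√(CT)` comes from `hA.sum`.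
  have h2 : ∑ k ∈ Finset.range (count a T i e), (μ i e + (2 * √(C / k) + C / k))
      ≤ count a T i e * μ i e + (4 * √(C * T) + C * (1 + Real.log T)) := by
    rw [Finset.sum_add_distrib, Finset.sum_add_distrib, ← Finset.mul_sum]
    have := sum_range_sqrt_div_le hC (count a T i e)
    have := sum_range_div_le hC (count_le a T i e)
    simp only [Finset.sum_const, Finset.card_range, nsmul_eq_mul]
    linarith
  have h3 : ∑ t ∈ Finset.range T, v t i e * assigned (a t) i e
      = ∑ s ∈ (Finset.range T).filter (fun s => a s e = i), v s i e := by
    rw [Finset.sum_filter]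
    exact Finset.sum_congr rfl fun t _ => by simp [assigned]
  have := hA.sum i e
  rw [h3]
  linarith

/-- The welfare bound on the event that the confidence bounds are accurate. -/
lemma le_welfare (h : IsRun T C ε a v) (hA : Accurate T C a v μ) (hn : 2 ≤ n) (hm : 0 < m)
    (hT : n ≤ T) (h0 : 0 < ε) (h1 : ε < 1) (hC : 0 < C) (hμ0 : ∀ i e, 0 ≤ μ i e)
    (hμ1 : ∀ i e, μ i e ≤ 1) (hv : ∀ t < T, ∀ i e, 0 ≤ v t i e) {p : ℝ} (hp0 : 0 ≤ p)
    {x : Fin n → Fin m → ℝ} (hx : LPFeasible μ p x) :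
    p * ((T : ℝ) - n)
        * (1 - ε - n * Real.exp (-(ε ^ 2 * (p * ((T : ℝ) - n)) / (2 * m))))
        - (14 * (m * √(C * T)) + m * C * (1 + Real.log T))
      ≤ welfare T v a := by
  have hn0 : 0 < n := by omega
  have : Nonempty (Fin n) := ⟨⟨0, hn0⟩⟩
  have hm' : (0 : ℝ) < m := by exact_mod_cast hm
  have hn' : (2 : ℝ) ≤ n := by exact_mod_cast hn
  have hT' : (n : ℝ) ≤ T := by exact_mod_cast hT
  have hlogT : 0 ≤ Real.log T := Real.log_nonneg (by linarith)
  refine le_ciInf fun i => ?_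
  set W := p * ((T : ℝ) - n) with hW
  have hW0 : 0 ≤ W := mul_nonneg hp0 (by linarith)
  have hE : 0 ≤ 14 * (m * √(C * T)) + m * C * (1 + Real.log T) := by positivity
  have hu0 : 0 ≤ utility T v a i := Finset.sum_nonneg fun t ht => Finset.sum_nonneg fun e _ =>
    mul_nonneg (hv t (Finset.mem_range.mp ht) i e) (assigned_nonneg _ _ _)
  set X := (n : ℝ) * Real.exp (-(ε ^ 2 * W / (2 * m))) with hX
  have hX0 : 0 ≤ X := by positivity
  -- For `X ≥ 1` the claimed lower bound is at most `0`. The exponential term enters only through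
  -- this case split; for `X < 1` it says that `m log n` is at most `ε²W/2`.
  rcases le_or_gt 1 X with hX1 | hX1
  · nlinarith
  have hlog : m * Real.log n ≤ ε ^ 2 * W / 2 := by
    have h2 := Real.log_le_log (by positivity) hX1.le
    rw [hX, Real.log_one, Real.log_mul (by positivity) (Real.exp_pos _).ne', Real.log_exp] at h2
    have h3 : m * Real.log n ≤ m * (ε ^ 2 * W / (2 * m)) :=
      mul_le_mul_of_nonneg_left (by linarith) hm'.le
    refine h3.trans (le_of_eq ?_)
    field_simp
  have hZ := lp_le_sum_truncGain h hA hn0 hT h1 hC hμ0 hμ1 hx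
  have hV : ∀ s, n ≤ s → s < T → ∀ i e, 0 ≤ ucb C a v s i e :=
    fun s hs hsT i e => (hμ0 i e).trans (hA.lower s hs hsT i e)
  have hcum := le_cumUcb hn0 hm h0 h1 hT hV i
  have hLe : ε ≤ -Real.log (1 - ε) := by
    have := Real.log_le_sub_one_of_pos (by linarith : (0 : ℝ) < 1 - ε)
    linarith
  have hL1 := one_sub_mul_neg_log_le h0 h1
  set L := -Real.log (1 - ε)
  have hL0 : 0 < L := h0.trans_le hLe
  have hA2 := hA.cumUcb_le hC.le hμ0 i
  set E := (m : ℝ) * √(C * T) with hEdef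
  have hE0 : 0 ≤ E := by positivity
  -- `L(1 - ε)W ≤ εW - ε²W/2`, and the last term pays for `m log n`; the error may be multiplied by
  -- `L` instead of `ε` because `ε ≤ L`.
  have hkey : L * (W * (1 - ε) - 9 * E) ≤ L * cumUcb C a v T i := by
    refine le_trans ?_ hcum
    have s1 : L * (W * (1 - ε)) ≤ W * (ε - ε ^ 2 / 2) := by
      nlinarith
    have s2 : ε * (W - 9 * E) ≤ ε * ∑ s ∈ Finset.Ico n T, truncGain C ε a v s :=
      mul_le_mul_of_nonneg_left (by linarith) h0.le
    have s3 : ε * (9 * E) ≤ L * (9 * E) := mul_le_mul_of_nonneg_right hLe (by positivity)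
    nlinarith
  have hkey2 := le_of_mul_le_mul_left hkey hL0
  have : 0 ≤ W * X := mul_nonneg hW0 hX0
  have e5 : (m : ℝ) * (5 * √(C * T) + C * (1 + Real.log T)) = 5 * E + m * C * (1 + Real.log T) := by
    rw [hEdef]; ring
  rw [e5] at hA2
  nlinarith

end

/-! ### Concentration of adaptively observed values. -/

section

/-- The intersections `A ∩ B` form a π-system generating `m₁ ⊔ m₂`, and probabilities factor on it.
-/
lemma indep_sup_of_indep {Ω : Type*} {m₁ m₂ m₃ mΩ : MeasurableSpace Ω} {P : Measure Ω}
    [IsProbabilityMeasure P] (h₁ : m₁ ≤ mΩ) (h₂ : m₂ ≤ mΩ) (h₃ : m₃ ≤ mΩ)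
    (h : Indep m₁ (m₂ ⊔ m₃) P) (h' : Indep m₂ m₃ P) : Indep (m₁ ⊔ m₂) m₃ P := by
  set π : Set (Set Ω) :=
    {s | ∃ A B, MeasurableSet[m₁] A ∧ MeasurableSet[m₂] B ∧ s = A ∩ B} with hπ
  have hpi : IsPiSystem π := by
    rintro _ ⟨A, B, hA, hB, rfl⟩ _ ⟨A', B', hA', hB', rfl⟩ _
    exact ⟨A ∩ A', B ∩ B', hA.inter hA', hB.inter hB', Set.inter_inter_inter_comm _ _ _ _⟩
  have hgen : m₁ ⊔ m₂ = MeasurableSpace.generateFrom π := by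
    refine le_antisymm (sup_le (fun A hA => ?_) fun B hB => ?_)
      (MeasurableSpace.generateFrom_le ?_)
    · exact MeasurableSpace.measurableSet_generateFrom
        ⟨A, Set.univ, hA, MeasurableSet.univ, by simp⟩
    · exact MeasurableSpace.measurableSet_generateFrom
        ⟨Set.univ, B, MeasurableSet.univ, hB, by simp⟩
    · rintro _ ⟨A, B, hA, hB, rfl⟩
      exact MeasurableSet.inter (le_sup_left (a := m₁) (b := m₂) A hA)
        (le_sup_right (a := m₁) (b := m₂) B hB)
  refine IndepSets.indep (sup_le h₁ h₂) h₃ hpi (@MeasurableSpace.isPiSystem_measurableSet Ω m₃)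
    hgen (@MeasurableSpace.generateFrom_measurableSet Ω m₃).symm ?_
  rw [IndepSets_iff]
  rintro _ D ⟨A, B, hA, hB, rfl⟩ hD
  have hB' : MeasurableSet[m₂ ⊔ m₃] B := le_sup_left (a := m₂) (b := m₃) B hB
  have hD' : MeasurableSet[m₂ ⊔ m₃] D := le_sup_right (a := m₂) (b := m₃) D hD
  rw [Indep_iff] at h h'
  rw [Set.inter_assoc, h A (B ∩ D) hA (hB'.inter hD'), h' B D hB hD, h A B hA hB', mul_assoc]

section Filtration

variable {Ω S : Type*} {n m : ℕ} [MeasurableSpace S]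

/-- The information carried by the seed and by all values of the rounds before round `t`. -/
abbrev past (ξ : Ω → S) (v : ℕ → Fin n → Fin m → Ω → ℝ) (t : ℕ) : MeasurableSpace Ω :=
  MeasurableSpace.comap ξ inferInstance ⊔
    ⨆ (s : ℕ) (_ : s < t) (i : Fin n) (e : Fin m), MeasurableSpace.comap (v s i e) inferInstance

variable {ξ : Ω → S} {v : ℕ → Fin n → Fin m → Ω → ℝ} {a : ℕ → Ω → Alloc n m} {T : ℕ}

lemma comap_le_past {s t : ℕ} (h : s < t) (i : Fin n) (e : Fin m) :
    MeasurableSpace.comap (v s i e) inferInstance ≤ past ξ v t :=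
  le_sup_of_le_right (le_iSup₂_of_le s h (le_iSup₂_of_le i e le_rfl))

lemma past_mono {s t : ℕ} (h : s ≤ t) : past ξ v s ≤ past ξ v t :=
  sup_le le_sup_left (iSup₂_le fun _ hr => iSup₂_le fun i e => comap_le_past (hr.trans_le h) i e)

lemma past_le [mΩ : MeasurableSpace Ω] (hξ : Measurable ξ)
    (hv : ∀ t < T, ∀ i e, Measurable (v t i e)) {t : ℕ} (ht : t ≤ T) : past ξ v t ≤ mΩ :=
  sup_le hξ.comap_le (iSup₂_le fun s hs => iSup₂_le fun i e => (hv s (hs.trans_le ht) i e).comap_le)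

lemma measurable_feedback {mΩ : MeasurableSpace Ω} {b : Ω → Alloc n m}
    {w : Fin n → Fin m → Ω → ℝ} (hb : Measurable b) (hw : ∀ i e, Measurable (w i e)) :
    Measurable fun ω (e : Fin m) => w (b ω e) e ω := by
  refine measurable_pi_lambda _ fun e => ?_
  have : (fun ω => w (b ω e) e ω) = fun ω => ∑ i, if b ω e = i then w i e ω else 0 := by
    ext ω; simp
  rw [this]
  refine Finset.measurable_sum _ fun i _ => Measurable.ite ?_ (hw i e) measurable_const
  exact ((measurable_pi_apply e).comp hb) (measurableSet_singleton i)

/-- Replaces the adaptive σ-algebra by one that does not mention the allocations. By strong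
induction earlier allocations are functions of the past, hence so is the feedback they select. -/
lemma info_le_past (ha : ∀ t < T, Measurable[info ξ v a t] (a t)) {t : ℕ} (ht : t ≤ T) :
    info ξ v a t ≤ past ξ v t := by
  induction t using Nat.strong_induction_on with
  | _ t ih =>
    refine sup_le le_sup_left (iSup₂_le fun s hs => ?_)
    have hs' : Measurable[past ξ v t] (a s) :=
      (ha s (hs.trans_le ht)).mono ((ih s hs (hs.le.trans ht)).trans (past_mono hs.le)) le_rfl
    refine sup_le hs'.comap_le ?_
    have hf := @measurable_feedback Ω n m (past ξ v t) (a s) (v s) hs' fun i e =>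
      Measurable.of_comap_le (comap_le_past hs i e)
    exact hf.comap_le

lemma measurable_past (ha : ∀ t < T, Measurable[info ξ v a t] (a t)) {s t : ℕ} (hst : s ≤ t)
    (hs : s < T) : Measurable[past ξ v t] (a s) :=
  (ha s hs).mono ((info_le_past ha hs.le).trans (past_mono hst)) le_rfl

lemma indep_past [mΩ : MeasurableSpace Ω] {P : Measure Ω} [IsProbabilityMeasure P]
    (hξ : Measurable ξ) (hv : ∀ t < T, ∀ i e, Measurable (v t i e))
    (hind : iIndepFun (fun (p : Fin T × Fin n × Fin m) => v p.1 p.2.1 p.2.2) P)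
    (hindξ : IndepFun ξ (fun ω (p : Fin T × Fin n × Fin m) => v p.1 p.2.1 p.2.2 ω) P)
    {t : ℕ} (ht : t < T) (i : Fin n) (e : Fin m) :
    Indep (past ξ v t) (MeasurableSpace.comap (v t i e) inferInstance) P := by
  set V : Fin T × Fin n × Fin m → Ω → ℝ := fun p => v p.1 p.2.1 p.2.2 with hV
  have hVm : ∀ p, Measurable (V p) := fun p => hv p.1 p.1.2 p.2.1 p.2.2
  set A : Finset (Fin T × Fin n × Fin m) := Finset.univ.filter fun p => (p.1 : ℕ) < t with hA
  set B : Finset (Fin T × Fin n × Fin m) := {(⟨t, ht⟩, i, e)} with hB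
  have hAB : Disjoint A B := by
    rw [hB, Finset.disjoint_singleton_right, hA]
    simp
  have h1 := hind.indepFun_finset A B hAB hVm
  have hm₂le : MeasurableSpace.comap (fun ω (p : A) => V p ω) inferInstance ≤ mΩ :=
    Measurable.comap_le (measurable_pi_lambda _ fun p => hVm p)
  set m₂ := MeasurableSpace.comap (fun ω (p : A) => V p ω) inferInstance with hm₂
  set m₃ := MeasurableSpace.comap (v t i e) inferInstance with hm₃
  have hB3 : m₃ ≤ MeasurableSpace.comap (fun ω (p : B) => V p ω) inferInstance := by
    have : v t i e = (fun f : B → ℝ => f ⟨(⟨t, ht⟩, i, e), by simp [hB]⟩)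
        ∘ fun ω (p : B) => V p ω := rfl
    rw [hm₃, this, ← MeasurableSpace.comap_comp]
    exact MeasurableSpace.comap_mono (Measurable.comap_le (measurable_pi_apply _))
  have hind23 : Indep m₂ m₃ P := indep_of_indep_of_le_right h1 hB3
  have hfull : m₂ ⊔ m₃ ≤ MeasurableSpace.comap (fun ω p => V p ω) inferInstance := by
    refine sup_le ?_ ?_
    · have : (fun ω (p : A) => V p ω)
          = (fun (f : Fin T × Fin n × Fin m → ℝ) (p : A) => f p) ∘ fun ω p => V p ω := rfl
      rw [hm₂, this, ← MeasurableSpace.comap_comp]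
      exact MeasurableSpace.comap_mono
        (Measurable.comap_le (measurable_pi_lambda _ fun p => measurable_pi_apply _))
    · have : v t i e = (fun f : Fin T × Fin n × Fin m → ℝ => f (⟨t, ht⟩, i, e))
          ∘ fun ω p => V p ω := rfl
      rw [hm₃, this, ← MeasurableSpace.comap_comp]
      exact MeasurableSpace.comap_mono (Measurable.comap_le (measurable_pi_apply _))
  have hind1 : Indep (MeasurableSpace.comap ξ inferInstance) (m₂ ⊔ m₃) P :=
    indep_of_indep_of_le_right hindξ hfull
  refine indep_of_indep_of_le_left
    (indep_sup_of_indep hξ.comap_le hm₂le (hv t ht i e).comap_le hind1 hind23) ?_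
  refine sup_le_sup_left (iSup₂_le fun s hs => iSup₂_le fun j f => ?_) _
  have : v s j f = (fun g : A → ℝ => g ⟨(⟨s, hs.trans ht⟩, j, f), by simp [hA, hs]⟩)
      ∘ fun ω (p : A) => V p ω := rfl
  rw [hm₂, this, ← MeasurableSpace.comap_comp]
  exact MeasurableSpace.comap_mono (Measurable.comap_le (measurable_pi_apply _))

open scoped ENNReal

/-- The product of a nonnegative function of the observed values of an item for an agent is a
supermartingale if the function has mean at most `1`. -/
lemma lintegral_prod_observed_le [mΩ : MeasurableSpace Ω] {P : Measure Ω}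
    [IsProbabilityMeasure P] (hξ : Measurable ξ) (hv : ∀ t < T, ∀ i e, Measurable (v t i e))
    (hind : iIndepFun (fun (p : Fin T × Fin n × Fin m) => v p.1 p.2.1 p.2.2) P)
    (hindξ : IndepFun ξ (fun ω (p : Fin T × Fin n × Fin m) => v p.1 p.2.1 p.2.2 ω) P)
    (ha : ∀ t < T, Measurable[info ξ v a t] (a t)) (i : Fin n) (e : Fin m) {D : Measure ℝ}
    (hD : ∀ t < T, P.map (v t i e) = D) {g : ℝ → ℝ≥0∞} (hg : Measurable g)
    (hg1 : ∫⁻ y, g y ∂D ≤ 1) {t : ℕ} (ht : t ≤ T) :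
    ∫⁻ ω, ∏ s ∈ Finset.range t, (if a s ω e = i then g (v s i e ω) else 1) ∂P ≤ 1 := by
  induction t with
  | zero => simp
  | succ t ih =>
    have htT : t < T := ht
    have hp := past_le hξ hv htT.le
    set M : Ω → ℝ≥0∞ := fun ω => ∏ s ∈ Finset.range t, (if a s ω e = i then g (v s i e ω) else 1)
      with hM
    have hset : ∀ s ≤ t, MeasurableSet[past ξ v t] {ω | a s ω e = i} := fun s hs =>
      ((measurable_pi_apply e).comp (measurable_past ha hs (hs.trans_lt htT)))
        (measurableSet_singleton i)
    have hMm : Measurable[past ξ v t] M := by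
      refine Finset.measurable_fun_prod _ fun s hs => ?_
      rw [Finset.mem_range] at hs
      exact Measurable.ite (hset s hs.le)
        (hg.comp (Measurable.of_comap_le (comap_le_past hs i e))) measurable_const
    -- Whether `i` receives `e` is decided by the past, so the new factor is independent of `M1` and
    -- absent from `M2`.
    set M1 : Ω → ℝ≥0∞ := fun ω => if a t ω e = i then M ω else 0 with hM1
    have hM1m : Measurable[past ξ v t] M1 := Measurable.ite (hset t le_rfl) hMm measurable_const
    set M2 : Ω → ℝ≥0∞ := fun ω => if a t ω e = i then 0 else M ω with hM2
    have hM2m : Measurable[past ξ v t] M2 := Measurable.ite (hset t le_rfl) measurable_const hMm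
    have hgm : Measurable[MeasurableSpace.comap (v t i e) inferInstance] fun ω => g (v t i e ω) :=
      hg.comp (comap_measurable _)
    have hsplit : ∀ ω, ∏ s ∈ Finset.range (t + 1), (if a s ω e = i then g (v s i e ω) else 1)
        = M1 ω * g (v t i e ω) + M2 ω := by
      intro ω
      rw [Finset.prod_range_succ, hM1, hM2]
      by_cases h : a t ω e = i <;> simp [h, hM]
    have hgle : ∫⁻ ω, g (v t i e ω) ∂P ≤ 1 := by
      rw [← lintegral_map hg (hv t htT i e), hD t htT]
      exact hg1
    calc ∫⁻ ω, ∏ s ∈ Finset.range (t + 1), (if a s ω e = i then g (v s i e ω) else 1) ∂P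
        = ∫⁻ ω, M1 ω * g (v t i e ω) ∂P + ∫⁻ ω, M2 ω ∂P := by
          simp_rw [hsplit]
          exact lintegral_add_right _ (hM2m.mono hp le_rfl)
      _ = (∫⁻ ω, M1 ω ∂P) * (∫⁻ ω, g (v t i e ω) ∂P) + ∫⁻ ω, M2 ω ∂P := by
          congr 1
          exact lintegral_mul_eq_lintegral_mul_lintegral_of_independent_measurableSpace hp
            (hv t htT i e).comap_le (indep_past hξ hv hind hindξ htT i e) hM1m hgm
      _ ≤ (∫⁻ ω, M1 ω ∂P) + ∫⁻ ω, M2 ω ∂P := by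
          gcongr
          exact mul_le_of_le_one_right' hgle
      _ = ∫⁻ ω, M ω ∂P := by
          rw [← lintegral_add_right _ (hM2m.mono hp le_rfl)]
          refine lintegral_congr fun ω => ?_
          by_cases h : a t ω e = i <;> simp [hM1, hM2, h]
      _ ≤ 1 := ih htT.le

/-- Markov's inequality for the exponential product. The count is fixed to `k` because the best
exponent depends on it; a union bound later removes this. -/
lemma measure_deviation_le [mΩ : MeasurableSpace Ω] {P : Measure Ω}
    [IsProbabilityMeasure P] (hξ : Measurable ξ) (hv : ∀ t < T, ∀ i e, Measurable (v t i e))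
    (hind : iIndepFun (fun (p : Fin T × Fin n × Fin m) => v p.1 p.2.1 p.2.2) P)
    (hindξ : IndepFun ξ (fun ω (p : Fin T × Fin n × Fin m) => v p.1 p.2.1 p.2.2 ω) P)
    (ha : ∀ t < T, Measurable[info ξ v a t] (a t)) (i : Fin n) (e : Fin m) {D : Measure ℝ}
    (hD : ∀ t < T, P.map (v t i e) = D) {h : ℝ → ℝ} (hh : Measurable h) {σ C : ℝ} (hσ : 0 < σ)
    (hC : 0 ≤ C)
    (hmgf : ∀ l, 0 ≤ l → ∫⁻ y, ENNReal.ofReal (Real.exp (l * h y - σ * l ^ 2 / 2)) ∂D ≤ 1)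
    {t k : ℕ} (ht : t ≤ T) (hk : 0 < k) :
    P {ω | count (fun t => a t ω) t i e = k ∧
        √(C * k * σ) < ∑ s ∈ Finset.range t, if a s ω e = i then h (v s i e ω) else 0}
      ≤ ENNReal.ofReal (Real.exp (-(C / 2))) := by
  have hk' : (0 : ℝ) < k := by exact_mod_cast hk
  -- The Chernoff optimum: at the threshold `l` times the sum is `C`, and the compensator `kσl²/2`
  -- is `C/2`.
  set l := √(C / (k * σ)) with hl
  have hl0 : 0 ≤ l := Real.sqrt_nonneg _
  have hl2 : k * σ * l ^ 2 = C := by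
    rw [hl, Real.sq_sqrt (by positivity)]
    field_simp
  have hlC : l * √(C * k * σ) = C := by
    rw [hl, ← Real.sqrt_mul (by positivity)]
    have : C / (k * σ) * (C * k * σ) = C ^ 2 := by field_simp
    rw [this, Real.sqrt_sq hC]
  set g : ℝ → ℝ≥0∞ := fun y => ENNReal.ofReal (Real.exp (l * h y - σ * l ^ 2 / 2)) with hg
  have hgm : Measurable g := by fun_prop
  have hprod : ∀ ω, ∏ s ∈ Finset.range t, (if a s ω e = i then g (v s i e ω) else 1)
      = ENNReal.ofReal (Real.exp (l * (∑ s ∈ Finset.range t, if a s ω e = i then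
          h (v s i e ω) else 0) - count (fun t => a t ω) t i e * (σ * l ^ 2 / 2))) := by
    intro ω
    have h1 : l * (∑ s ∈ Finset.range t, if a s ω e = i then h (v s i e ω) else 0)
        - count (fun t => a t ω) t i e * (σ * l ^ 2 / 2)
        = ∑ s ∈ Finset.range t, if a s ω e = i then
          (l * h (v s i e ω) - σ * l ^ 2 / 2) else 0 := by
      rw [count, Finset.card_filter, Nat.cast_sum, Finset.mul_sum, Finset.sum_mul,
        ← Finset.sum_sub_distrib]
      exact Finset.sum_congr rfl fun s _ => by split_ifs <;> simp
    rw [h1, Real.exp_sum, ENNReal.ofReal_prod_of_nonneg fun _ _ => (Real.exp_pos _).le]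
    exact Finset.prod_congr rfl fun s _ => by split_ifs <;> simp [hg]
  have hint := lintegral_prod_observed_le hξ hv hind hindξ ha i e hD hgm (hmgf l hl0) ht
  set F : Ω → ℝ≥0∞ := fun ω =>
    ∏ s ∈ Finset.range t, (if a s ω e = i then g (v s i e ω) else 1) with hF
  have hFm : Measurable F := by
    refine Finset.measurable_fun_prod _ fun s hs => ?_
    have hsT : s < T := (Finset.mem_range.mp hs).trans_le ht
    refine Measurable.ite ?_ (hgm.comp (hv s hsT i e)) measurable_const
    exact ((measurable_pi_apply e).comp ((measurable_past ha le_rfl hsT).mono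
      (past_le hξ hv hsT.le) le_rfl)) (measurableSet_singleton i)
  have hpos : ENNReal.ofReal (Real.exp (C / 2)) ≠ 0 := by
    rw [Ne, ENNReal.ofReal_eq_zero, not_le]
    exact Real.exp_pos _
  calc _ ≤ P {ω | ENNReal.ofReal (Real.exp (C / 2)) ≤ F ω} := by
        refine measure_mono fun ω hω => ?_
        obtain ⟨h1, h2⟩ := hω
        simp only [Set.mem_ofPred_eq, hF]
        rw [hprod ω, h1]
        refine ENNReal.ofReal_le_ofReal (Real.exp_le_exp.mpr ?_)
        have := mul_le_mul_of_nonneg_left h2.le hl0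
        rw [hlC] at this
        linarith
    _ ≤ (∫⁻ ω, F ω ∂P) / ENNReal.ofReal (Real.exp (C / 2)) :=
        meas_ge_le_lintegral_div hFm.aemeasurable hpos ENNReal.ofReal_ne_top
    _ ≤ 1 / ENNReal.ofReal (Real.exp (C / 2)) := by gcongr
    _ = ENNReal.ofReal (Real.exp (-(C / 2))) := by
        rw [one_div, Real.exp_neg, ENNReal.ofReal_inv_of_pos (Real.exp_pos _)]

end Filtration

/-- For `f` in `[0, 1]`, `f² ≤ f` makes the quadratic bound on `exp (-l f)` linear in `f`, so the
mean serves as variance proxy. This is the lower tail, and it is valid for every `l ≥ 0`. -/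
lemma lintegral_exp_le_one {D : Measure ℝ} [IsProbabilityMeasure D] {f : ℝ → ℝ}
    (hf : Measurable f) (hf01 : ∀ᵐ y ∂D, f y ∈ Set.Icc (0 : ℝ) 1) {σ : ℝ}
    (hσ : ∫ y, f y ∂D ≤ σ) {l : ℝ} (hl : 0 ≤ l) :
    ∫⁻ y, ENNReal.ofReal (Real.exp (l * (∫ y, f y ∂D - f y) - σ * l ^ 2 / 2)) ∂D ≤ 1 := by
  have hfi : Integrable f D := by
    refine Integrable.of_bound hf.aestronglyMeasurable 1 ?_
    filter_upwards [hf01] with y hy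
    rw [Real.norm_eq_abs, abs_of_nonneg hy.1]
    exact hy.2
  set ν := ∫ y, f y ∂D with hν
  set c := Real.exp (l * ν - σ * l ^ 2 / 2) with hc
  have hb : ∀ᵐ y ∂D, Real.exp (l * (ν - f y) - σ * l ^ 2 / 2)
      ≤ c * (1 - (l - l ^ 2 / 2) * f y) := by
    filter_upwards [hf01] with y hy
    have e1 : l * (ν - f y) - σ * l ^ 2 / 2 = (l * ν - σ * l ^ 2 / 2) + -(l * f y) := by ring
    rw [e1, Real.exp_add]
    refine mul_le_mul_of_nonneg_left ?_ (Real.exp_pos _).le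
    refine (exp_neg_le_quadratic (mul_nonneg hl hy.1)).trans ?_
    have : f y ^ 2 ≤ f y := by nlinarith [hy.1, hy.2]
    nlinarith [sq_nonneg l]
  have hi : Integrable (fun y => c * (1 - (l - l ^ 2 / 2) * f y)) D :=
    ((integrable_const _).sub (hfi.const_mul _)).const_mul _
  calc _ ≤ ∫⁻ y, ENNReal.ofReal (c * (1 - (l - l ^ 2 / 2) * f y)) ∂D :=
        lintegral_mono_ae (hb.mono fun y hy => ENNReal.ofReal_le_ofReal hy)
    _ = ENNReal.ofReal (∫ y, c * (1 - (l - l ^ 2 / 2) * f y) ∂D) :=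
        (ofReal_integral_eq_lintegral_ofReal hi
          (hb.mono fun y hy => (Real.exp_pos _).le.trans hy)).symm
    _ ≤ 1 := by
        rw [← ENNReal.ofReal_one]
        apply ENNReal.ofReal_le_ofReal
        rw [integral_const_mul, integral_sub (integrable_const _) (hfi.const_mul _),
          integral_const_mul, ← hν]
        simp only [integral_const, probReal_univ, smul_eq_mul, mul_one]
        have h1 : 1 - (l - l ^ 2 / 2) * ν ≤ Real.exp (-((l - l ^ 2 / 2) * ν)) := by
          have := Real.add_one_le_exp (-((l - l ^ 2 / 2) * ν))
          linarith
        calc c * (1 - (l - l ^ 2 / 2) * ν)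
            ≤ c * Real.exp (-((l - l ^ 2 / 2) * ν)) :=
              mul_le_mul_of_nonneg_left h1 (Real.exp_pos _).le
          _ = Real.exp (-((σ - ν) * l ^ 2 / 2)) := by
              rw [hc, ← Real.exp_add]
              congr 1
              ring
          _ ≤ 1 := by
              rw [Real.exp_le_one_iff]
              have : 0 ≤ (σ - ν) * l ^ 2 := mul_nonneg (by linarith) (sq_nonneg l)
              linarith

end

/-! ### Accuracy of the confidence bounds with high probability. -/

section

variable {n m T : ℕ}

/-- Deviation bounds for the observed values imply that the confidence bounds are accurate. -/
lemma IsRun.accurate {C ε : ℝ} {a : ℕ → Alloc n m} {v : ℕ → Fin n → Fin m → ℝ}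
    {μ : Fin n → Fin m → ℝ} (h : IsRun T C ε a v) (hT : n ≤ T) (hC : 0 ≤ C)
    (hμ0 : ∀ i e, 0 ≤ μ i e) (hμ1 : ∀ i e, μ i e ≤ 1)
    (hv1 : ∀ t < T, ∀ i e, v t i e ≤ 1) (hv0 : ∀ t < T, ∀ i e, 0 ≤ v t i e)
    (hlow : ∀ t ≤ T, ∀ i e, 0 < count a t i e →
      ∑ s ∈ Finset.range t, (if a s e = i then μ i e - v s i e else 0)
        ≤ √(C * count a t i e * μ i e))
    (hup : ∀ t ≤ T, ∀ i e, 0 < count a t i e →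
      ∑ s ∈ Finset.range t, (if a s e = i then v s i e - μ i e else 0)
        ≤ √(C * count a t i e)) :
    Accurate T C a v μ := by
  have hsum : ∀ t i e, ∑ s ∈ Finset.range t, (if a s e = i then v s i e - μ i e else 0)
      = ∑ s ∈ (Finset.range t).filter (fun s => a s e = i), v s i e
        - count a t i e * μ i e := by
    intro t i e
    rw [← Finset.sum_filter, Finset.sum_sub_distrib, Finset.sum_const, nsmul_eq_mul, count]
  have hsum' : ∀ t i e, ∑ s ∈ Finset.range t, (if a s e = i then μ i e - v s i e else 0)
      = count a t i e * μ i e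
        - ∑ s ∈ (Finset.range t).filter (fun s => a s e = i), v s i e := by
    intro t i e
    rw [← Finset.sum_filter, Finset.sum_sub_distrib, Finset.sum_const, nsmul_eq_mul, count]
  -- the sample mean in terms of the observed sum
  have hmean : ∀ t, n ≤ t → ∀ i e, (count a t i e : ℝ) * sampleMean a v t i e
      = ∑ s ∈ (Finset.range t).filter (fun s => a s e = i), v s i e := by
    intro t ht i e
    have : (0 : ℝ) < count a t i e := by exact_mod_cast count_pos h ht i e
    rw [sampleMean, mul_div_cancel₀ _ this.ne']
  have hsm : ∀ t, n ≤ t → t ≤ T → ∀ i e,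
      0 ≤ sampleMean a v t i e ∧ sampleMean a v t i e ≤ 1 := by
    intro t ht htT i e
    have hN : (0 : ℝ) < count a t i e := by exact_mod_cast count_pos h ht i e
    have hs : ∀ s ∈ (Finset.range t).filter (fun s => a s e = i), s < T := fun s hs =>
      (Finset.mem_range.mp (Finset.mem_filter.mp hs).1).trans_le htT
    constructor
    · exact div_nonneg (Finset.sum_nonneg fun s hs' => hv0 s (hs s hs') i e) hN.le
    · rw [sampleMean, div_le_one hN]
      calc _ ≤ ∑ _s ∈ (Finset.range t).filter (fun s => a s e = i), (1 : ℝ) :=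
            Finset.sum_le_sum fun s hs' => hv1 s (hs s hs') i e
        _ = count a t i e := by simp [count]
  have hsq : ∀ t, n ≤ t → ∀ i e, ∀ y, 0 ≤ y →
      √(C * count a t i e * y) = count a t i e * (√(C / count a t i e) * √y) := by
    intro t ht i e y hy
    have hN : (0 : ℝ) < count a t i e := by exact_mod_cast count_pos h ht i e
    rw [← Real.sqrt_mul (by positivity)]
    nth_rewrite 2 [← Real.sqrt_sq hN.le]
    rw [← Real.sqrt_mul (by positivity)]
    congr 1
    field_simp
  refine ⟨fun t ht htT i e => ?_, fun t ht htT i e => ?_, fun i e => ?_⟩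
  · have hN : (0 : ℝ) < count a t i e := by exact_mod_cast count_pos h ht i e
    have h1 := hlow t htT.le i e (count_pos h ht i e)
    rw [hsum', ← hmean t ht, hsq t ht i e _ (hμ0 i e), ← mul_sub] at h1
    have h2 := le_of_mul_le_mul_left h1 hN
    have hM0 := (hsm t ht htT.le i e).1
    unfold ucb rad
    set N := (count a t i e : ℝ)
    set M := sampleMean a v t i e
    set r := √(C / N) with hr
    have hr0 : 0 ≤ r := Real.sqrt_nonneg _
    have hr2 : r ^ 2 = C / N := Real.sq_sqrt (by positivity)
    have hs : √(C * M / N) = r * √M := by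
      rw [hr, ← Real.sqrt_mul (by positivity)]
      congr 1
      ring
    rw [hs, ← hr2]
    have hx2 : √(μ i e) ^ 2 = μ i e := Real.sq_sqrt (hμ0 i e)
    have hy2 : √M ^ 2 = M := Real.sq_sqrt hM0
    have hy0 := Real.sqrt_nonneg M
    have hx0 := Real.sqrt_nonneg (μ i e)
    -- Solves `μ - M ≤ r√μ` for `√μ`; reinserting gives `μ ≤ M + r√M + r²`, exactly the confidence
    -- bound.
    have hxy : √(μ i e) ≤ r + √M := by
      by_contra hcon
      push Not at hcon
      nlinarith
    nlinarith [mul_le_mul_of_nonneg_left hxy hr0]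
  · have hN : (0 : ℝ) < count a t i e := by exact_mod_cast count_pos h ht i e
    have h1 := hup t htT.le i e (count_pos h ht i e)
    have h3 := hsq t ht i e 1 zero_le_one
    rw [mul_one, Real.sqrt_one, mul_one] at h3
    rw [hsum, ← hmean t ht, h3, ← mul_sub] at h1
    have h2 := le_of_mul_le_mul_left h1 hN
    unfold ucb rad
    have hle : √(C * sampleMean a v t i e / count a t i e) ≤ √(C / count a t i e) := by
      apply Real.sqrt_le_sqrt
      gcongr
      exact mul_le_of_le_one_right hC (hsm t ht htT.le i e).2
    linarith
  · have h1 := hlow T le_rfl i e (count_pos h hT i e)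
    rw [hsum'] at h1
    have hle : √(C * count a T i e * μ i e) ≤ √(C * count a T i e) :=
      Real.sqrt_le_sqrt (mul_le_of_le_one_right (by positivity) (hμ1 i e))
    linarith

section Probability

variable {Ω S : Type*} [MeasurableSpace Ω] [MeasurableSpace S] {P : Measure Ω}
  {ξ : Ω → S} {v : ℕ → Fin n → Fin m → Ω → ℝ} {a : ℕ → Ω → Alloc n m}
  {D : Fin n → Fin m → Measure ℝ} {μ : Fin n → Fin m → ℝ}

lemma ae_mem_Icc_of_map (hD01 : ∀ i e, D i e (Set.Icc 0 1)ᶜ = 0)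
    (hv : ∀ t < T, ∀ i e, Measurable (v t i e)) (hD : ∀ t < T, ∀ i e, P.map (v t i e) = D i e) :
    ∀ᵐ ω ∂P, ∀ t < T, ∀ i e, v t i e ω ∈ Set.Icc (0 : ℝ) 1 := by
  rw [ae_all_iff]
  intro t
  by_cases ht : t < T
  swap
  · exact Filter.Eventually.of_forall fun ω h => absurd h ht
  have : ∀ᵐ ω ∂P, ∀ i e, v t i e ω ∈ Set.Icc (0 : ℝ) 1 := by
    rw [ae_all_iff]
    intro i
    rw [ae_all_iff]
    intro e
    refine ae_of_ae_map (hv t ht i e).aemeasurable (p := fun y => y ∈ Set.Icc (0 : ℝ) 1) ?_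
    rw [hD t ht i e]
    exact hD01 i e
  exact this.mono fun ω h _ => h

lemma mean_mem_Icc (hDp : ∀ i e, IsProbabilityMeasure (D i e))
    (hD01 : ∀ i e, D i e (Set.Icc 0 1)ᶜ = 0) (hμ : ∀ i e, μ i e = ∫ y, y ∂(D i e))
    (i : Fin n) (e : Fin m) : μ i e ∈ Set.Icc (0 : ℝ) 1 := by
  have := hDp i e
  have h01 : ∀ᵐ y ∂(D i e), y ∈ Set.Icc (0 : ℝ) 1 := hD01 i e
  rw [hμ]
  refine ⟨integral_nonneg_of_ae (h01.mono fun y hy => hy.1), ?_⟩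
  have hi : Integrable (fun y : ℝ => y) (D i e) := by
    refine Integrable.of_bound measurable_id.aestronglyMeasurable 1 ?_
    filter_upwards [h01] with y hy
    rw [Real.norm_eq_abs, abs_of_nonneg hy.1]
    exact hy.2
  calc ∫ y, y ∂(D i e) ≤ ∫ _y, (1 : ℝ) ∂(D i e) :=
        integral_mono_ae hi (integrable_const _) (h01.mono fun y hy => hy.2)
    _ = 1 := by simp

/-- A union bound over the rounds, the sample sizes, the agents and the items. -/
lemma measure_exists_deviation_le {A : ℕ → ℕ → Fin n → Fin m → Set Ω} {δ : ℝ}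
    (hA : ∀ t ≤ T, ∀ k, 0 < k → ∀ i e, P (A t k i e) ≤ ENNReal.ofReal δ) :
    P {ω | ∃ t ≤ T, ∃ k ≤ T, 0 < k ∧ ∃ i e, ω ∈ A t k i e}
      ≤ ENNReal.ofReal ((T + 1) * T * n * m * δ) := by
  calc _ ≤ P (⋃ p : Fin (T + 1) × Fin T × Fin n × Fin m,
        A p.1 (p.2.1 + 1) p.2.2.1 p.2.2.2) := by
        refine measure_mono ?_
        rintro ω ⟨t, ht, k, hk, hk0, i, e, hω⟩
        refine Set.mem_iUnion.mpr ⟨(⟨t, by omega⟩, ⟨k - 1, by omega⟩, i, e), ?_⟩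
        simpa [Nat.sub_add_cancel hk0] using hω
    _ ≤ ∑ p : Fin (T + 1) × Fin T × Fin n × Fin m, P (A p.1 (p.2.1 + 1) p.2.2.1 p.2.2.2) :=
        measure_iUnion_fintype_le _ _
    _ ≤ ∑ _p : Fin (T + 1) × Fin T × Fin n × Fin m, ENNReal.ofReal δ :=
        Finset.sum_le_sum fun p _ => hA p.1 (by omega) _ (Nat.succ_pos _) _ _
    _ = ENNReal.ofReal ((T + 1) * T * n * m * δ) := by
        rw [Finset.sum_const, Finset.card_univ, ← ENNReal.ofReal_nsmul]
        congr 1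
        simp only [Fintype.card_prod, Fintype.card_fin, nsmul_eq_mul]
        push_cast
        ring

/-- With high probability the confidence bounds are accurate. -/
lemma measure_not_accurate_le [IsProbabilityMeasure P] (hT : n ≤ T) (hDp : ∀ i e, IsProbabilityMeasure (D i e))
    (hD01 : ∀ i e, D i e (Set.Icc 0 1)ᶜ = 0) (hμ : ∀ i e, μ i e = ∫ y, y ∂(D i e))
    (hv : ∀ t < T, ∀ i e, Measurable (v t i e))
    (hD : ∀ t < T, ∀ i e, P.map (v t i e) = D i e)
    (hind : iIndepFun (fun (p : Fin T × Fin n × Fin m) => v p.1 p.2.1 p.2.2) P)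
    (hξ : Measurable ξ)
    (hindξ : IndepFun ξ (fun ω (p : Fin T × Fin n × Fin m) => v p.1 p.2.1 p.2.2 ω) P)
    {C ε : ℝ} (hC : 0 ≤ C) (ha : ∀ t < T, Measurable[info ξ v a t] (a t))
    (hrun : ∀ ω, IsRun T C ε (fun t => a t ω) (fun t i e => v t i e ω)) :
    P {ω | ¬ Accurate T C (fun t => a t ω) (fun t i e => v t i e ω) μ}
      ≤ ENNReal.ofReal (2 * ((T + 1) * T * n * m * Real.exp (-(C / 2)))) := by
  have hμ01 := mean_mem_Icc hDp hD01 hμ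
  have hae : ∀ i e, ∀ᵐ y ∂(D i e), y ∈ Set.Icc (0 : ℝ) 1 := fun i e => hD01 i e
  have hlow : ∀ t ≤ T, ∀ k, 0 < k → ∀ i e,
      P {ω | 0 < μ i e ∧ count (fun t => a t ω) t i e = k ∧ √(C * k * μ i e)
        < ∑ s ∈ Finset.range t, if a s ω e = i then μ i e - v s i e ω else 0}
      ≤ ENNReal.ofReal (Real.exp (-(C / 2))) := by
    intro t ht k hk i e
    have := hDp i e
    -- The Chernoff exponent divides by `σ = μ i e`. A zero mean needs no probability estimate: the
    -- sum of `-v` is nonpositive.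
    by_cases hpos : 0 < μ i e
    swap
    · simp [hpos]
    simp only [hpos, true_and]
    refine measure_deviation_le hξ hv hind hindξ ha i e (fun t ht => hD t ht i e)
      (h := fun y => μ i e - y) (by fun_prop) hpos hC (fun l hl => ?_) ht hk
    have hl' := lintegral_exp_le_one (f := fun y => y) measurable_id (hae i e)
      (hμ i e).ge hl
    rwa [← hμ] at hl'
  have hup : ∀ t ≤ T, ∀ k, 0 < k → ∀ i e,
      P {ω | count (fun t => a t ω) t i e = k ∧ √(C * k * 1)
        < ∑ s ∈ Finset.range t, if a s ω e = i then v s i e ω - μ i e else 0}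
      ≤ ENNReal.ofReal (Real.exp (-(C / 2))) := by
    intro t ht k hk i e
    have := hDp i e
    refine measure_deviation_le hξ hv hind hindξ ha i e (fun t ht => hD t ht i e)
      (h := fun y => y - μ i e) (by fun_prop) one_pos hC (fun l hl => ?_) ht hk
    have hi : Integrable (fun y : ℝ => y) (D i e) := by
      refine Integrable.of_bound measurable_id.aestronglyMeasurable 1 ?_
      filter_upwards [hae i e] with y hy
      rw [Real.norm_eq_abs, abs_of_nonneg hy.1]
      exact hy.2
    have hint : ∫ y, (1 - y) ∂(D i e) = 1 - μ i e := by
      rw [integral_sub (integrable_const _) hi, hμ]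
      simp
    -- The upper tail is the lower tail of `1 - y`, with the cruder proxy `1 ≥ 1 - μ`.
    have hl' := lintegral_exp_le_one (D := D i e) (f := fun y => 1 - y) (by fun_prop)
      ((hae i e).mono fun y hy => ⟨by linarith [hy.2], by linarith [hy.1]⟩) (σ := 1)
      (by rw [hint]; linarith [(hμ01 i e).1]) hl
    rw [hint] at hl'
    simpa only [sub_sub_sub_cancel_left] using hl'
  have h1 := measure_exists_deviation_le hlow
  have h2 := measure_exists_deviation_le hup
  have hnull : P {ω | ¬ ∀ t < T, ∀ i e, v t i e ω ∈ Set.Icc (0 : ℝ) 1} = 0 :=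
    ae_mem_Icc_of_map hD01 hv hD
  set B1 := {ω | ∃ t ≤ T, ∃ k ≤ T, 0 < k ∧ ∃ i e, ω ∈ {ω | 0 < μ i e ∧
      count (fun t => a t ω) t i e = k ∧ √(C * k * μ i e)
        < ∑ s ∈ Finset.range t, if a s ω e = i then μ i e - v s i e ω else 0}} with hB1
  set B2 := {ω | ∃ t ≤ T, ∃ k ≤ T, 0 < k ∧ ∃ i e, ω ∈ {ω |
      count (fun t => a t ω) t i e = k ∧ √(C * k * 1)
        < ∑ s ∈ Finset.range t, if a s ω e = i then v s i e ω - μ i e else 0}} with hB2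
  set B0 := {ω | ¬ ∀ t < T, ∀ i e, v t i e ω ∈ Set.Icc (0 : ℝ) 1}
  have hsub : {ω | ¬ Accurate T C (fun t => a t ω) (fun t i e => v t i e ω) μ}
      ⊆ B0 ∪ (B1 ∪ B2) := by
    intro ω hω
    by_contra hcon
    rw [Set.mem_union, Set.mem_union, not_or, not_or] at hcon
    obtain ⟨h0, hn1, hn2⟩ := hcon
    have h0' : ∀ t < T, ∀ i e, v t i e ω ∈ Set.Icc (0 : ℝ) 1 := not_not.mp h0
    refine hω ((hrun ω).accurate hT hC (fun i e => (hμ01 i e).1) (fun i e => (hμ01 i e).2)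
      (fun t ht i e => (h0' t ht i e).2) (fun t ht i e => (h0' t ht i e).1) ?_ ?_)
    · intro t ht i e hk
      by_contra hlt
      push Not at hlt
      rcases (hμ01 i e).1.eq_or_lt with hz | hpos
      · rw [← hz, mul_zero, Real.sqrt_zero] at hlt
        refine hlt.not_ge (Finset.sum_nonpos fun s hs => ?_)
        have := (h0' s ((Finset.mem_range.mp hs).trans_le ht) i e).1
        split_ifs <;> linarith
      · exact hn1 ⟨t, ht, _, (count_le _ t i e).trans ht, hk, i, e, hpos, rfl, hlt⟩
    · intro t ht i e hk
      by_contra hlt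
      push Not at hlt
      refine hn2 ⟨t, ht, _, (count_le _ t i e).trans ht, hk, i, e, rfl, ?_⟩
      rwa [mul_one]
  calc _ ≤ P (B0 ∪ (B1 ∪ B2)) := measure_mono hsub
    _ ≤ P B0 + (P B1 + P B2) :=
        (measure_union_le _ _).trans (add_le_add_right (measure_union_le _ _) _)
    _ ≤ 0 + (ENNReal.ofReal ((T + 1) * T * n * m * Real.exp (-(C / 2)))
        + ENNReal.ofReal ((T + 1) * T * n * m * Real.exp (-(C / 2)))) := by
        rw [hnull]
        gcongr
    _ = _ := by
        rw [zero_add, ← ENNReal.ofReal_add (by positivity) (by positivity), two_mul]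

end Probability

end

/-! ### The offline benchmark and the explicit regret bound. -/

section

variable {n m T : ℕ} {μ : Fin n → Fin m → ℝ}

lemma IsLPOptimal.le {p p' : ℝ} {x x' : Fin n → Fin m → ℝ} (hT : 0 < T)
    (h : IsLPOptimal T μ p x) (h' : LPFeasible μ p' x') : p' ≤ p :=
  le_of_mul_le_mul_left (h.2 p' x' h') (by exact_mod_cast hT)

lemma IsLPOptimal.nonneg {p : ℝ} {x : Fin n → Fin m → ℝ} (hT : 0 < T) (hn : 0 < n)
    (hμ0 : ∀ i e, 0 ≤ μ i e) (h : IsLPOptimal T μ p x) : 0 ≤ p :=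
  h.le hT (x' := assigned fun _ => ⟨0, hn⟩)
    ⟨fun i => Finset.sum_nonneg fun e _ => mul_nonneg (hμ0 i e) (assigned_nonneg _ i e),
      fun e => by simp [assigned], assigned_nonneg _, assigned_le_one _⟩

/-- The linear program relaxes the offline problem. -/
lemma IsLPOptimal.welfare_le {p : ℝ} {x : Fin n → Fin m → ℝ} (hT : 0 < T)
    (h : IsLPOptimal T μ p x) (y : ℕ → Alloc n m) : welfare T (fun _ => μ) y ≤ T * p := by
  have hT' : (0 : ℝ) < T := by exact_mod_cast hT
  -- The time average of the allocations is a fractional solution.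
  have hf : LPFeasible μ (welfare T (fun _ => μ) y / T)
      (fun i e => (∑ t ∈ Finset.range T, assigned (y t) i e) / T) := by
    refine ⟨fun i => ?_, fun e => ?_, fun i e => ?_, fun i e => ?_⟩
    · rw [div_le_iff₀ hT']
      refine (ciInf_le (Set.finite_range _).bddBelow i).trans (le_of_eq ?_)
      rw [utility, Finset.sum_comm, Finset.sum_mul]
      refine Finset.sum_congr rfl fun e _ => ?_
      rw [← Finset.mul_sum]
      field_simp
    · rw [← Finset.sum_div, Finset.sum_comm]
      have : ∀ t, ∑ i, assigned (y t) i e = 1 := fun t => by simp [assigned]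
      simp [this, hT'.ne']
    · exact div_nonneg (Finset.sum_nonneg fun t _ => assigned_nonneg _ i e) hT'.le
    · rw [div_le_one hT']
      calc _ ≤ ∑ _t ∈ Finset.range T, (1 : ℝ) :=
            Finset.sum_le_sum fun t _ => assigned_le_one _ i e
        _ = T := by simp
  have := h.le hT hf
  rw [div_le_iff₀ hT'] at this
  linarith

lemma utility_mem_Icc {w : ℕ → Fin n → Fin m → ℝ}
    (hw : ∀ t < T, ∀ i e, w t i e ∈ Set.Icc (0 : ℝ) 1) (a : ℕ → Alloc n m) (i : Fin n) :
    utility T w a i ∈ Set.Icc (0 : ℝ) (T * m) := by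
  constructor
  · exact Finset.sum_nonneg fun t ht => Finset.sum_nonneg fun e _ =>
      mul_nonneg (hw t (Finset.mem_range.mp ht) i e).1 (assigned_nonneg _ i e)
  · calc utility T w a i ≤ ∑ _t ∈ Finset.range T, ∑ _e : Fin m, (1 : ℝ) :=
          Finset.sum_le_sum fun t ht => Finset.sum_le_sum fun e _ =>
            mul_le_one₀ (hw t (Finset.mem_range.mp ht) i e).2 (assigned_nonneg _ i e)
              (assigned_le_one _ i e)
      _ = T * m := by simp

lemma welfare_mem_Icc (hn : 0 < n) {w : ℕ → Fin n → Fin m → ℝ}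
    (hw : ∀ t < T, ∀ i e, w t i e ∈ Set.Icc (0 : ℝ) 1) (a : ℕ → Alloc n m) :
    welfare T w a ∈ Set.Icc (0 : ℝ) (T * m) := by
  have : Nonempty (Fin n) := ⟨⟨0, hn⟩⟩
  exact ⟨le_ciInf fun i => (utility_mem_Icc hw a i).1,
    (ciInf_le (Set.finite_range _).bddBelow ⟨0, hn⟩).trans (utility_mem_Icc hw a _).2⟩

section Probability

variable {Ω : Type*} [MeasurableSpace Ω] {P : Measure Ω}
  {v : ℕ → Fin n → Fin m → Ω → ℝ} {a : ℕ → Ω → Alloc n m}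

lemma measurable_utility (hv : ∀ t < T, ∀ i e, Measurable (v t i e))
    (ha : ∀ t < T, Measurable (a t)) (i : Fin n) :
    Measurable fun ω => utility T (fun t i e => v t i e ω) (fun t => a t ω) i := by
  refine Finset.measurable_sum _ fun t ht => Finset.measurable_sum _ fun e _ => ?_
  rw [Finset.mem_range] at ht
  exact (hv t ht i e).mul ((Measurable.of_discrete (f := fun b => assigned b i e)).comp (ha t ht))

lemma integrable_utility [IsProbabilityMeasure P] (hv : ∀ t < T, ∀ i e, Measurable (v t i e))
    (hv01 : ∀ᵐ ω ∂P, ∀ t < T, ∀ i e, v t i e ω ∈ Set.Icc (0 : ℝ) 1)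
    (ha : ∀ t < T, Measurable (a t)) (i : Fin n) :
    Integrable (fun ω => utility T (fun t i e => v t i e ω) (fun t => a t ω) i) P := by
  refine Integrable.of_bound (measurable_utility hv ha i).aestronglyMeasurable (T * m) ?_
  filter_upwards [hv01] with ω hω
  have := utility_mem_Icc hω (fun t => a t ω) i
  rw [Real.norm_eq_abs, abs_of_nonneg this.1]
  exact this.2

lemma integrable_welfare [IsProbabilityMeasure P] (hn : 0 < n) (hv : ∀ t < T, ∀ i e, Measurable (v t i e))
    (hv01 : ∀ᵐ ω ∂P, ∀ t < T, ∀ i e, v t i e ω ∈ Set.Icc (0 : ℝ) 1)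
    (ha : ∀ t < T, Measurable (a t)) :
    Integrable (fun ω => welfare T (fun t i e => v t i e ω) (fun t => a t ω)) P := by
  refine Integrable.of_bound
    (Measurable.iInf fun i => measurable_utility hv ha i).aestronglyMeasurable (T * m) ?_
  filter_upwards [hv01] with ω hω
  have := welfare_mem_Icc hn hω fun t => a t ω
  rw [Real.norm_eq_abs, abs_of_nonneg this.1]
  exact this.2

/-- The expected welfare of a fixed policy is at most its welfare for the expected values. -/
lemma integral_welfare_le [IsProbabilityMeasure P] (hn : 0 < n) (hv : ∀ t < T, ∀ i e, Measurable (v t i e))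
    (hv01 : ∀ᵐ ω ∂P, ∀ t < T, ∀ i e, v t i e ω ∈ Set.Icc (0 : ℝ) 1)
    (hmean : ∀ t < T, ∀ i e, ∫ ω, v t i e ω ∂P = μ i e) (x : ℕ → Alloc n m) :
    ∫ ω, welfare T (fun t i e => v t i e ω) x ∂P ≤ welfare T (fun _ => μ) x := by
  have : Nonempty (Fin n) := ⟨⟨0, hn⟩⟩
  have hvi : ∀ t < T, ∀ i e, Integrable (v t i e) P := fun t ht i e => by
    refine Integrable.of_bound (hv t ht i e).aestronglyMeasurable 1 ?_
    filter_upwards [hv01] with ω hω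
    rw [Real.norm_eq_abs, abs_of_nonneg (hω t ht i e).1]
    exact (hω t ht i e).2
  refine le_ciInf fun i => ?_
  calc ∫ ω, welfare T (fun t i e => v t i e ω) x ∂P
      ≤ ∫ ω, utility T (fun t i e => v t i e ω) x i ∂P :=
        integral_mono
          (integrable_welfare (a := fun t _ => x t) hn hv hv01 fun _ _ => measurable_const)
          (integrable_utility (a := fun t _ => x t) hv hv01 (fun _ _ => measurable_const) i)
          fun ω => ciInf_le (Set.finite_range _).bddBelow i
    _ = utility T (fun _ => μ) x i := by
        unfold utility
        rw [integral_finsetSum _ fun t ht => integrable_finsetSum _ fun e _ =>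
          (hvi t (Finset.mem_range.mp ht) i e).mul_const _]
        refine Finset.sum_congr rfl fun t ht => ?_
        rw [Finset.mem_range] at ht
        rw [integral_finsetSum _ fun e _ => (hvi t ht i e).mul_const _]
        refine Finset.sum_congr rfl fun e _ => ?_
        rw [integral_mul_const, hmean t ht]

/-- A nonnegative random variable that is at least `B` outside an event of probability `δ` has
expectation at least `B` minus `B * δ`. -/
lemma le_integral_of_measure_le [IsProbabilityMeasure P] {f : Ω → ℝ} (hf : Integrable f P) (hf0 : ∀ᵐ ω ∂P, 0 ≤ f ω)
    {B δ c : ℝ} (hδ : 0 ≤ δ) (hc : 0 ≤ c) {A : Set Ω} (hA : P A ≤ ENNReal.ofReal δ)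
    (hB : ∀ᵐ ω ∂P, ω ∉ A → B ≤ f ω) (hBδ : B * δ ≤ c) : B - c ≤ ∫ ω, f ω ∂P := by
  rcases le_or_gt B 0 with hB0 | hB0
  · exact (by linarith : B - c ≤ 0).trans (integral_nonneg_of_ae hf0)
  -- `A` need not be measurable, so its measurable hull of equal measure is used.
  have hm := measurableSet_toMeasurable P A
  have hPA : P.real (toMeasurable P A) ≤ δ := by
    rw [measureReal_def, measure_toMeasurable]
    exact ENNReal.toReal_le_of_le_ofReal hδ hA
  calc B - c ≤ B * (1 - P.real (toMeasurable P A)) := by nlinarith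
    _ = ∫ ω, (toMeasurable P A)ᶜ.indicator (fun _ => B) ω ∂P := by
        rw [integral_indicator_const _ hm.compl, probReal_compl_eq_one_sub hm, smul_eq_mul,
          mul_comm]
    _ ≤ ∫ ω, f ω ∂P := by
        refine integral_mono_ae ((integrable_const B).indicator hm.compl) hf ?_
        filter_upwards [hf0, hB] with ω h0 hω
        by_cases hmem : ω ∈ toMeasurable P A
        · simpa [hmem] using h0
        · simpa [hmem] using hω fun h => hmem (subset_toMeasurable P A h)

end Probability

/-- With `q = mnT`, the factor `6` gives `exp (-C/2) ≤ q⁻³`, which cancels `W ≤ q`, `T + 1 ≤ 2q` and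
`Tnm = q`. -/
lemma failure_bound {C W : ℝ} (hn : 0 < n) (hm : 0 < m) (hT : 0 < T) (hWT : W ≤ m * T)
    (hC : 6 * Real.log ((m : ℝ) * n * T) ≤ C) :
    W * (2 * ((T + 1) * T * n * m * Real.exp (-(C / 2)))) ≤ 4 := by
  have hn' : (1 : ℝ) ≤ n := by exact_mod_cast hn
  have hm' : (1 : ℝ) ≤ m := by exact_mod_cast hm
  have hT' : (1 : ℝ) ≤ T := by exact_mod_cast hT
  set q : ℝ := (m : ℝ) * n * T with hq
  have hq0 : 0 < q := by positivity
  have hexp : Real.exp (-(C / 2)) ≤ (q ^ 3)⁻¹ := by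
    calc Real.exp (-(C / 2)) ≤ Real.exp (-((3 : ℕ) * Real.log q)) :=
          Real.exp_le_exp.mpr (by push_cast; linarith)
      _ = (q ^ 3)⁻¹ := by rw [Real.exp_neg, Real.exp_nat_mul, Real.exp_log hq0]
  have hmT : (m : ℝ) * T ≤ q := by
    rw [hq]
    nlinarith [mul_nonneg (by positivity : (0 : ℝ) ≤ m * T) (by linarith : (0 : ℝ) ≤ n - 1)]
  have hTq : (T : ℝ) + 1 ≤ 2 * q := by
    nlinarith [mul_nonneg (by linarith : (0 : ℝ) ≤ m - 1) (by linarith : (0 : ℝ) ≤ T)]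
  calc W * (2 * ((T + 1) * T * n * m * Real.exp (-(C / 2))))
      ≤ q * (2 * ((2 * q) * q * (q ^ 3)⁻¹)) := by
        have e1 : ((T : ℝ) + 1) * T * n * m * Real.exp (-(C / 2))
            = (T + 1) * q * Real.exp (-(C / 2)) := by rw [hq]; ring
        rw [e1]
        have h0 : (0 : ℝ) ≤ 2 * ((T + 1) * q * Real.exp (-(C / 2))) := by positivity
        refine (mul_le_mul_of_nonneg_right (hWT.trans hmT) h0).trans ?_
        gcongr
    _ = 4 := by field_simp; norm_num

/-- The regret bound with explicit constants. -/
lemma regret_le {D : Fin n → Fin m → Measure ℝ} (hn : 2 ≤ n) (hm : 0 < m) (hT : n ≤ T)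
    (hDp : ∀ i e, IsProbabilityMeasure (D i e)) (hD01 : ∀ i e, D i e (Set.Icc 0 1)ᶜ = 0)
    (hμ : ∀ i e, μ i e = ∫ y, y ∂(D i e))
    {Ω : Type*} [MeasurableSpace Ω] {P : Measure Ω} [IsProbabilityMeasure P]
    {v : ℕ → Fin n → Fin m → Ω → ℝ} {S : Type*} [MeasurableSpace S] {ξ : Ω → S}
    (hv : ∀ t < T, ∀ i e, Measurable (v t i e))
    (hD : ∀ t < T, ∀ i e, P.map (v t i e) = D i e)
    (hind : iIndepFun (fun (p : Fin T × Fin n × Fin m) => v p.1 p.2.1 p.2.2) P)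
    (hξ : Measurable ξ)
    (hindξ : IndepFun ξ (fun ω (p : Fin T × Fin n × Fin m) => v p.1 p.2.1 p.2.2 ω) P)
    (x : ℕ → Alloc n m) {p : ℝ} {y : Fin n → Fin m → ℝ} (hp : IsLPOptimal T μ p y)
    {C ε : ℝ} (hC : 6 * Real.log ((m : ℝ) * n * T) ≤ C) (hC0 : 0 < C) (h0 : 0 < ε) (h1 : ε < 1)
    {a : ℕ → Ω → Alloc n m} (ha : ∀ t < T, Measurable[info ξ v a t] (a t))
    (hrun : ∀ ω, IsRun T C ε (fun t => a t ω) (fun t i e => v t i e ω)) :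
    regret P T v x a ≤ m + p * ((T : ℝ) - n)
        * (ε + n * Real.exp (-(ε ^ 2 * (p * ((T : ℝ) - n)) / (2 * m))))
      + (4 + 14 * (m * √(C * T)) + m * C * (1 + Real.log T)) := by
  have hn0 : 0 < n := by omega
  have hT0 : 0 < T := by omega
  have hn' : (2 : ℝ) ≤ n := by exact_mod_cast hn
  have hT' : (n : ℝ) ≤ T := by exact_mod_cast hT
  have hm' : (0 : ℝ) < m := by exact_mod_cast hm
  have hμ01 := mean_mem_Icc hDp hD01 hμ
  have hv01 := ae_mem_Icc_of_map hD01 hv hD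
  have ham : ∀ t < T, Measurable (a t) := fun t ht =>
    (measurable_past ha le_rfl ht).mono (past_le hξ hv ht.le) le_rfl
  have hp0 := hp.nonneg hT0 hn0 fun i e => (hμ01 i e).1
  have hnp := hp.1.mul_le fun i e => (hμ01 i e).2
  have hmean : ∀ t < T, ∀ i e, ∫ ω, v t i e ω ∂P = μ i e := fun t ht i e => by
    rw [hμ, ← hD t ht, integral_map (hv t ht i e).aemeasurable
      (f := fun y => y) measurable_id.aestronglyMeasurable]
  have hopt := (integral_welfare_le hn0 hv hv01 hmean x).trans (hp.welfare_le hT0 x)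
  have hintO := integrable_welfare (P := P) (a := fun t _ => x t) hn0 hv hv01
    fun _ _ => measurable_const
  have hintA := integrable_welfare (P := P) hn0 hv hv01 ham
  have hlogT : 0 ≤ Real.log T := Real.log_nonneg (by linarith)
  set W := p * ((T : ℝ) - n) with hW
  set X := n * Real.exp (-(ε ^ 2 * W / (2 * m))) with hX
  have hW0 : 0 ≤ W := mul_nonneg hp0 (by linarith)
  have hX0 : 0 ≤ X := by positivity
  set E := 14 * (m * √(C * T)) + m * C * (1 + Real.log T) with hE
  have hE0 : 0 ≤ E := by positivity
  have hWm : W ≤ m * T := by nlinarith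
  have halg : W * (1 - ε - X) - E - 4
      ≤ ∫ ω, welfare T (fun t i e => v t i e ω) (fun t => a t ω) ∂P := by
    refine le_integral_of_measure_le hintA
      (hv01.mono fun ω hω => (welfare_mem_Icc hn0 hω _).1) (by positivity) (by norm_num)
      (measure_not_accurate_le hT hDp hD01 hμ hv hD hind hξ hindξ hC0.le ha hrun)
      (hv01.mono fun ω hω hA => ?_) (failure_bound hn0 hm hT0 ?_ hC)
    · have hA' : Accurate T C (fun t => a t ω) (fun t i e => v t i e ω) μ := not_not.mp hA
      exact le_welfare (hrun ω) hA' hn hm hT h0 h1 hC0 (fun i e => (hμ01 i e).1)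
        (fun i e => (hμ01 i e).2) (fun t ht i e => (hω t ht i e).1) hp0 hp.1
    · nlinarith [mul_nonneg hW0 hX0]
  rw [regret, integral_sub hintO hintA]
  -- The initialization rounds cost `n * p ≤ m`.
  have : (T : ℝ) * p = W + n * p := by rw [hW]; ring
  nlinarith

lemma regret_eq_zero {Ω : Type*} [MeasurableSpace Ω] (P : Measure Ω)
    (v : ℕ → Fin 1 → Fin m → Ω → ℝ) (x : ℕ → Alloc 1 m) (a : ℕ → Ω → Alloc 1 m) :
    regret P T v x a = 0 := by
  have : ∀ ω, (fun t => a t ω) = x := fun ω => Subsingleton.elim _ _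
  simp [regret, this]

/-- With the choice `ε = log (T - n) / √(T - n)` the exponential term is bounded. -/
lemma lp_mul_exp_le {p ε : ℝ} (hm : 0 < m) (hp : 0 < p)
    (hT : Real.exp (2 * m / p) + n ≤ T) (hε : ε = Real.log ((T : ℝ) - n) / √((T : ℝ) - n)) :
    p * ((T : ℝ) - n) * (n * Real.exp (-(ε ^ 2 * (p * ((T : ℝ) - n)) / (2 * m)))) ≤ n * p := by
  have hm' : (0 : ℝ) < m := by exact_mod_cast hm
  set d := (T : ℝ) - n with hd
  have hed : Real.exp (2 * m / p) ≤ d := by linarith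
  have hd0 : 0 < d := (Real.exp_pos _).trans_le hed
  have hl : 2 * m / p ≤ Real.log d := (Real.le_log_iff_exp_le hd0).mpr hed
  rw [div_le_iff₀ hp] at hl
  have hl0 : 0 ≤ Real.log d := by
    by_contra hneg
    push Not at hneg
    nlinarith
  -- The exponent is `p (log d)² / (2m)`, which is at least `log d` because `p log d ≥ 2m`.
  have hexp : Real.exp (-(ε ^ 2 * (p * d) / (2 * m))) ≤ d⁻¹ := by
    rw [← Real.exp_log hd0, ← Real.exp_neg, Real.exp_log hd0]
    refine Real.exp_le_exp.mpr (neg_le_neg ?_)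
    have : ε ^ 2 * (p * d) = Real.log d ^ 2 * p := by
      rw [hε, div_pow, Real.sq_sqrt hd0.le]
      field_simp
    rw [this, le_div_iff₀ (by positivity)]
    nlinarith
  calc p * d * (n * Real.exp (-(ε ^ 2 * (p * d) / (2 * m)))) ≤ p * d * (n * d⁻¹) := by gcongr
    _ = n * p := by field_simp

end

/-! ### Simplification of the error terms. -/

section

variable {n m T : ℕ} {C : ℝ}

lemma log_le_log_size (hn : 0 < n) (hm : 0 < m) (hT : 0 < T) :
    Real.log T ≤ Real.log ((m : ℝ) * n * T) := by
  have hmn : (1 : ℝ) ≤ (m : ℝ) * n := by exact_mod_cast Nat.mul_pos hm hn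
  exact Real.log_le_log (by exact_mod_cast hT) (le_mul_of_one_le_left (by positivity) hmn)

lemma one_le_two_mul_log (hT : 2 ≤ T) : 1 ≤ 2 * Real.log T := by
  have h2 : Real.log 2 ≤ Real.log T := Real.log_le_log (by norm_num) (by exact_mod_cast hT)
  linarith [Real.log_two_gt_d9]

lemma three_le_radius (hn : 0 < n) (hm : 0 < m) (hT : 2 ≤ T)
    (hC : 6 * Real.log ((m : ℝ) * n * T) ≤ C) : 3 ≤ C := by
  linarith [log_le_log_size hn hm (by omega : 0 < T), one_le_two_mul_log hT]

lemma sqrt_mul_sq_mul (C : ℝ) (m T : ℕ) : √(C * (m : ℝ) ^ 2 * T) = m * √(C * T) := by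
  have : C * (m : ℝ) ^ 2 * T = (m : ℝ) ^ 2 * (C * T) := by ring
  rw [this, Real.sqrt_mul (by positivity), Real.sqrt_sq (by positivity)]

lemma le_mul_sqrt (hC : 1 ≤ C) (hT : 1 ≤ T) : (m : ℝ) ≤ m * √(C * T) := by
  refine le_mul_of_one_le_right (by positivity) ?_
  rw [Real.one_le_sqrt]
  exact one_le_mul_of_one_le_of_one_le hC (by exact_mod_cast hT)

lemma radius_mul_one_add_log_le (hC : 0 ≤ C) (hT : 2 ≤ T) :
    m * C * (1 + Real.log T) ≤ 3 * (C * m * Real.log T) := by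
  calc m * C * (1 + Real.log T) ≤ m * C * (3 * Real.log T) := by
        refine mul_le_mul_of_nonneg_left ?_ (by positivity)
        linarith [one_le_two_mul_log hT]
    _ = 3 * (C * m * Real.log T) := by ring

lemma one_le_mul_sqrt_mul_log (hm : 0 < m) (hT : 2 ≤ T) : 1 ≤ (m : ℝ) * √(T * Real.log T) := by
  refine one_le_mul_of_one_le_of_one_le (by exact_mod_cast hm) ?_
  rw [Real.one_le_sqrt]
  have hT' : (2 : ℝ) ≤ T := by exact_mod_cast hT
  have h := one_le_two_mul_log hT
  calc (1 : ℝ) ≤ 2 * Real.log T := h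
    _ ≤ T * Real.log T := mul_le_mul_of_nonneg_right hT' (by linarith)

/-- With the choice `ε = log (T - n) / √(T - n)` the linear term is of order `√T * log T`. -/
lemma lp_mul_step_le {p ε : ℝ} (hn : 0 < n) (hp : 0 < p) (hnp : n * p ≤ m)
    (hT : Real.exp (2 * m / p) + n ≤ T) (hε : ε = Real.log ((T : ℝ) - n) / √((T : ℝ) - n)) :
    p * ((T : ℝ) - n) * ε ≤ (m : ℝ) / n * √T * Real.log T := by
  have hn' : (0 : ℝ) < n := by exact_mod_cast hn
  have hd1 : 1 ≤ (T : ℝ) - n := by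
    have := Real.one_le_exp (show 0 ≤ 2 * (m : ℝ) / p by positivity)
    linarith
  have hle : p ≤ m / n := by
    rw [le_div_iff₀ hn']
    linarith
  have hs : √((T : ℝ) - n) ≠ 0 := (Real.sqrt_pos.mpr (by linarith)).ne'
  have hsq : √((T : ℝ) - n) * √((T : ℝ) - n) = (T : ℝ) - n := Real.mul_self_sqrt (by linarith)
  have hlog0 := Real.log_nonneg hd1
  have hlog : Real.log ((T : ℝ) - n) ≤ Real.log T := Real.log_le_log (by linarith) (by linarith)
  have hsqrt : √((T : ℝ) - n) ≤ √T := Real.sqrt_le_sqrt (by linarith)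
  calc p * ((T : ℝ) - n) * ε
      = p * (√((T : ℝ) - n) * √((T : ℝ) - n))
          * (Real.log ((T : ℝ) - n) / √((T : ℝ) - n)) := by rw [hsq, hε]
    _ = p * √((T : ℝ) - n) * Real.log ((T : ℝ) - n) := by field_simp
    _ ≤ m / n * √T * Real.log T := by gcongr

lemma radius_terms_le {c : ℝ} (hc : 0 ≤ c) (hq : 0 ≤ Real.log ((m : ℝ) * n * T))
    (hC : C ≤ c * Real.log ((m : ℝ) * n * T)) (hT0 : 1 ≤ T)
    (hT : Real.log T ^ 2 * Real.log ((m : ℝ) * n * T) ≤ T) :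
    m * √(C * T) + C * m * Real.log T
      ≤ (√c + c) * (m * √(T * Real.log ((m : ℝ) * n * T))) := by
  have hL : 0 ≤ Real.log T := Real.log_nonneg (by exact_mod_cast hT0)
  set q := Real.log ((m : ℝ) * n * T)
  have h1 : √(C * T) ≤ √c * √(T * q) := by
    rw [← Real.sqrt_mul hc]
    apply Real.sqrt_le_sqrt
    calc C * T ≤ c * q * T := by gcongr
      _ = c * (T * q) := by ring
  -- The extra condition on `T` is used here: it makes the term linear in `C` no larger than the
  -- square-root term.
  have hqL : q * Real.log T ≤ √(T * q) := by
    apply Real.le_sqrt_of_sq_le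
    calc (q * Real.log T) ^ 2 = Real.log T ^ 2 * q * q := by ring
      _ ≤ T * q := by gcongr
  calc m * √(C * T) + C * m * Real.log T
      ≤ m * (√c * √(T * q)) + c * q * m * Real.log T := by gcongr
    _ = m * (√c * √(T * q)) + c * m * (q * Real.log T) := by ring
    _ ≤ m * (√c * √(T * q)) + c * m * √(T * q) := by gcongr
    _ = (√c + c) * (m * √(T * q)) := by ring

end

end BMMFA

end

/-! ### Assembly of the constants. -/

theorem theorem1 :
    ∃ c₀ : ℝ, 0 < c₀ ∧ ∀ c₁ : ℝ, c₀ ≤ c₁ → ∃ K : ℝ,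
      ∀ (n m T : ℕ), 0 < n → 0 < m → n ≤ T →
      -- the unknown distributions on `[0, 1]`
      ∀ (D : Fin n → Fin m → Measure ℝ) (μ : Fin n → Fin m → ℝ),
        (∀ i e, IsProbabilityMeasure (D i e)) → (∀ i e, D i e (Set.Icc 0 1)ᶜ = 0) →
        (∀ i e, μ i e = ∫ y, y ∂(D i e)) →
      -- the independent random values, and an independent seed for tie-breaking
      ∀ {Ω : Type*} [MeasurableSpace Ω] (P : Measure Ω) [IsProbabilityMeasure P]
        (v : ℕ → Fin n → Fin m → Ω → ℝ)
        {S : Type*} [MeasurableSpace S] (ξ : Ω → S),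
        (∀ t < T, ∀ i e, Measurable (v t i e)) →
        (∀ t < T, ∀ i e, P.map (v t i e) = D i e) →
        iIndepFun (fun (p : Fin T × Fin n × Fin m) => v p.1 p.2.1 p.2.2) P →
        Measurable ξ →
        IndepFun ξ (fun ω (p : Fin T × Fin n × Fin m) => v p.1 p.2.1 p.2.2 ω) P →
      -- the optimal policy, and an optimal solution of the linear program
      ∀ (x : ℕ → BMMFA.Alloc n m), BMMFA.IsOptimalSeq T μ x →
      ∀ (Pstar : ℝ) (xstar : Fin n → Fin m → ℝ), BMMFA.IsLPOptimal T μ Pstar xstar →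
      -- the parameters and the run of the algorithm
      ∀ (C ε : ℝ),
        c₀ * Real.log ((m : ℝ) * n * T) ≤ C → C ≤ c₁ * Real.log ((m : ℝ) * n * T) →
        0 < ε → ε < 1 →
      ∀ (a : ℕ → Ω → BMMFA.Alloc n m),
        (∀ t < T, Measurable[BMMFA.info ξ v a t] (a t)) →
        (∀ ω, BMMFA.IsRun T C ε (fun t => a t ω) (fun t i e => v t i e ω)) →
      BMMFA.regret P T v x a ≤
          m + Pstar
            + Pstar * ((T : ℝ) - n)
                * (ε + n * Real.exp (-(ε ^ 2 * (Pstar * ((T : ℝ) - n)) / (2 * m))))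
            + K * (m * √(T * Real.log T) + (√(C * (m : ℝ) ^ 2 * T) + C * m * Real.log T)) ∧
      (0 < Pstar → Real.exp (2 * m / Pstar) + n ≤ T →
        ε = Real.log ((T : ℝ) - n) / √((T : ℝ) - n) →
        BMMFA.regret P T v x a ≤
            K * ((m : ℝ) / n * √T * Real.log T
              + (√(C * (m : ℝ) ^ 2 * T) + C * m * Real.log T)) ∧
        (Real.log T ^ 2 * Real.log ((m : ℝ) * n * T) ≤ T →
          BMMFA.regret P T v x a ≤
            K * ((m : ℝ) / n * √T * Real.log T
              + m * √(T * Real.log ((m : ℝ) * n * T))))) := by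
  refine ⟨6, by norm_num, fun c₁ hc₁ => ⟨20 * (1 + √c₁ + c₁), ?_⟩⟩
  intro n m T hn hm hT D μ hDp hD01 hμ Ω _ P _ v S _ ξ hv hD hind hξ hindξ x _ Pstar xstar hp C ε
    hC hC₁ h0 h1 a ha hrun
  have hT0 : 0 < T := by omega
  have hL0 : 0 ≤ Real.log T := Real.log_nonneg (by exact_mod_cast hT0)
  have hq0 := hL0.trans (BMMFA.log_le_log_size hn hm hT0)
  have hC0 : 0 ≤ C := le_trans (by positivity) hC
  have hμ01 := BMMFA.mean_mem_Icc hDp hD01 hμ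
  have hp0 := hp.nonneg hT0 hn fun i e => (hμ01 i e).1
  have hnp := hp.1.mul_le fun i e => (hμ01 i e).2
  have hd0 : (0 : ℝ) ≤ (T : ℝ) - n := by
    have : (n : ℝ) ≤ T := by exact_mod_cast hT
    linarith
  have hc₁0 : 0 ≤ c₁ := by linarith
  have hs₁0 := Real.sqrt_nonneg c₁
  have hK : 20 ≤ 20 * (1 + √c₁ + c₁) := by linarith
  -- A single agent has only one possible allocation, so the regret is `0`. This case is separate
  -- because `mnT = 1` would force `C = 0`.
  rcases Nat.lt_or_ge n 2 with hn2 | hn2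
  · obtain rfl : n = 1 := by omega
    rw [BMMFA.regret_eq_zero]
    exact ⟨by positivity, fun _ _ _ => ⟨by positivity, fun _ => by positivity⟩⟩
  have hT2 : 2 ≤ T := hn2.trans hT
  have hC3 := BMMFA.three_le_radius hn hm hT2 hC
  have hreg := BMMFA.regret_le hn2 hm hT hDp hD01 hμ hv hD hind hξ hindξ x hp hC (by linarith)
    h0 h1 ha hrun
  have hG := BMMFA.radius_mul_one_add_log_le (m := m) hC0 hT2
  have hF : 0 ≤ m * √(C * T) := by positivity
  have hG0 : 0 ≤ C * m * Real.log T := by positivity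
  rw [BMMFA.sqrt_mul_sq_mul]
  refine ⟨?_, fun hpos hTe hε => ?_⟩
  · have h4 := BMMFA.one_le_mul_sqrt_mul_log hm hT2
    have hsum := mul_le_mul_of_nonneg_right hK
      (by positivity : 0 ≤ m * √(T * Real.log T) + (m * √(C * T) + C * m * Real.log T))
    linarith
  have hX := (BMMFA.lp_mul_exp_le hm hpos hTe hε).trans hnp
  have hA := BMMFA.lp_mul_step_le hn hpos hnp hTe hε
  have hmF := BMMFA.le_mul_sqrt (m := m) (by linarith : 1 ≤ C) (by omega : 1 ≤ T)
  have hm1 : (1 : ℝ) ≤ m := by exact_mod_cast hm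
  have hA0 : 0 ≤ (m : ℝ) / n * √T * Real.log T := by positivity
  rw [mul_add] at hreg
  -- `20 = 1 + 1 + 4 + 14`: the terms `m`, `n * Pstar ≤ m` and `4 ≤ 4m` are absorbed into `m√(CT)`,
  -- next to its own coefficient `14`.
  have hR : BMMFA.regret P T v x a ≤ 20 * ((m : ℝ) / n * √T * Real.log T
      + (m * √(C * T) + C * m * Real.log T)) := by linarith
  refine ⟨hR.trans (mul_le_mul_of_nonneg_right hK (by positivity)), fun hTq => ?_⟩
  have hrad := BMMFA.radius_terms_le hc₁0 hq0 hC₁ hT0 hTq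
  refine hR.trans ?_
  have h5 := mul_nonneg (add_nonneg hs₁0 hc₁0) hA0
  have h6 : 0 ≤ m * √(T * Real.log ((m : ℝ) * n * T)) := by positivity
  linarith
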